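/- Let $q$ be an indeterminate, $\mathcal A=\mathbb Z[q,q^{-1}]$, $[m]=\frac{q^m-q^{-m}}{q-q^{-1}}$ for $m\in\mathbb Z$ and $[n]!=[1][2]\cdots[n]$. Let $\mathbf U=U_q(\mathfrak{sl}_2)$ be the $\mathbb Q(q)$-algebra generated by $E,F,K^{\pm1}$ with relations $KK^{-1}=K^{-1}K=1$, $EF-FE=\frac{K-K^{-1}}{q-q^{-1}}$, $KE=q^2EK$, $KF=q^{-2}FK$, and put $E^{(n)}=E^n/[n]!$, $F^{(n)}=F^n/[n]!$. Let $\mathfrak t=q^{-1}EK^{-1}+F$, let $\mathbf U^\imath=\mathbb Q(q)[\mathfrak t]\subset\mathbf U$, and define, for $a\ge 0$, $$\mathfrak t^{(2a)}_{\mathrm{odd}}=\frac{(\mathfrak t-[-2a+1])(\mathfrak t-[-2a+3])\cdots(\mathfrak t-[2a-1])}{[2a]!},\qquad \mathfrak t^{(2a+1)}_{\mathrm{odd}}=\frac{\mathfrak t\,(\mathfrak t-[-2a+1])(\mathfrak t-[-2a+3])\cdots(\mathfrak t-[2a-1])}{[2a+1]!}.$$ For $\mu\in\mathbb N$ let $L(\mu)$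 be the simple $\mathbf U$-module of highest weight $\mu$, with highest weight vector $v^+_\mu$. The bar involution of $\mathbf U^\imath$ is the ring involution with $q\mapsto q^{-1}$ and $\mathfrak t\mapsto\mathfrak t$. The bar involution $\psi_\imath$ of $L(\mu)$ is the additive involution that is semilinear for $q\mapsto q^{-1}$, commutes with $\mathfrak t$ and fixes $v^+_\mu$. The $\imath$-canonical basis of $L(\mu)$ is the family $(b^\mu_a)_{0\le a\le\mu}$ characterized by $\psi_\imath(b^\mu_a)=b^\mu_a$ and $b^\mu_a\in F^{(a)}v^+_\mu+\sum_{0\le r\le\mu}q^{-1}\mathbb Z[q^{-1}]F^{(r)}v^+_\mu$. The odd-weight $\imath$-canonical basis of $\mathbf U^\imath$ is the family $(u_n)_{n\in\mathbb N}$ in $\mathbf U^\imath$ characterized by $u_nv^+_{2\lambda+1}=b^{2\lambda+1}_n$ for each $n$ and all sufficiently large $\lambda$. Let ${}_{\mathcal A}\dot{\mathbf U}\mathbf 1_\nu$ be the image in $\dot{\mathbf U}\mathbf 1_\nu=\mathbf U/\mathbf U(K-q^\nu)$ of the $\mathcal A$-subalgebra of $\mathbf U$ generated by all $E^{(n)},F^{(n)}$.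 The odd-weight integral form of $\mathbf U^\imath$ is ${}_{\mathcal A}\mathbf U^\imath_{\mathrm{odd}}=\{x\in\mathbf U^\imath : x\cdot{}_{\mathcal A}\dot{\mathbf U}\mathbf 1_\nu\subset{}_{\mathcal A}\dot{\mathbf U}\mathbf 1_\nu\text{ for all odd }\nu\in\mathbb Z\}$. Theorem. (1) For each $\lambda\in\mathbb N$, the involution $\psi_\imath$ of $L(2\lambda+1)$ exists and is unique, and the $\imath$-canonical basis of $L(2\lambda+1)$ exists, is unique, and is the family $\big(\mathfrak t^{(n)}_{\mathrm{odd}}v^+_{2\lambda+1}\big)_{0\le n\le 2\lambda+1}$, that is, $b^{2\lambda+1}_n=\mathfrak t^{(n)}_{\mathrm{odd}}v^+_{2\lambda+1}$; it is a $\mathbb Q(q)$-basis of $L(2\lambda+1)$. Moreover $\mathfrak t^{(n)}_{\mathrm{odd}}v^+_{2\lambda+1}=0$ for $n>2\lambda+1$. (2) The odd-weight $\imath$-canonical basis of $\mathbf U^\imath$ exists, is unique, and is the family $\big(\mathfrak t^{(n)}_{\mathrm{odd}}\big)_{n\in\mathbb N}$. This family is a $\mathbb Q(q)$-basis of $\mathbf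 U^\imath$; the bar involution of $\mathbf U^\imath$ exists, is unique, and fixes each $\mathfrak t^{(n)}_{\mathrm{odd}}$; and the $\mathcal A$-span of the family is ${}_{\mathcal A}\mathbf U^\imath_{\mathrm{odd}}$. -/

import Mathlib

noncomputable section

namespace IotaQuantum

open Polynomial

/-! ### The ground field and quantum integers -/

/-- The field `ℚ(q)` of rational functions in one variable. -/
abbrev Qq : Type := RatFunc ℚ

/-- The variable `q`. -/
def q : Qq := RatFunc.X

lemma q_ne_zero : q ≠ 0 := RatFunc.X_ne_zero

lemma transcendental_X_inv (k : Type) [Field k] :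
    Transcendental k (RatFunc.X⁻¹ : RatFunc k) := by
  apply RatFunc.transcendental_of_ne_C
  rintro ⟨c, hc⟩
  have h1 : (RatFunc.X : RatFunc k) = RatFunc.C c⁻¹ := by rw [map_inv₀, ← hc, inv_inv]
  rw [← RatFunc.algebraMap_X, ← RatFunc.algebraMap_C] at h1
  exact X_ne_C c⁻¹ (RatFunc.algebraMap_injective k h1)

/-- The endomorphism of `k(q)` over `k` with `q ↦ q⁻¹`. -/
def invVar (k : Type) [Field k] : RatFunc k →+* RatFunc k :=
  ((IntermediateField.val _).comp
    (RatFunc.algEquivOfTranscendental (RatFunc.X⁻¹ : RatFunc k)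
      (transcendental_X_inv k)).toAlgHom).toRingHom

/-- The bar involution of `ℚ(q)`, with `q ↦ q⁻¹`. -/
def bar : Qq →+* Qq := invVar ℚ

lemma bar_q : bar q = q⁻¹ := by
  simp [bar, invVar, q]

/-- The quantum integer `[m] = (q^m - q^{-m}) / (q - q^{-1})`, for `m ∈ ℤ`. -/
def qint (m : ℤ) : Qq := (q ^ m - q ^ (-m)) / (q - q⁻¹)

/-- The quantum factorial `[n]! = [1][2]⋯[n]`. -/
def qfact (n : ℕ) : Qq := ∏ i ∈ Finset.range n, qint (i + 1)

/-- The ring `𝒜 = ℤ[q, q⁻¹]` inside `ℚ(q)`. -/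
def intLaurent : Subalgebra ℤ Qq := Algebra.adjoin ℤ {q, q⁻¹}

/-- The subset `q⁻¹ ℤ[q⁻¹]` of `ℚ(q)`. -/
def negLattice : Set Qq := {c | ∃ p : ℤ[X], c = q⁻¹ * aeval q⁻¹ p}

/-! ### The quantum group of `𝔰𝔩₂` -/

/-- Generators of the quantum group. -/
inductive Gen : Type
  | E | F | K | Kinv

/-- The generators inside the free algebra. -/
abbrev gen (g : Gen) : FreeAlgebra Qq Gen := FreeAlgebra.ι Qq g

/-- The defining relations of the quantum group of `𝔰𝔩₂`. -/
inductive Rel : FreeAlgebra Qq Gen → FreeAlgebra Qq Gen → Prop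
  | K_mul_Kinv : Rel (gen .K * gen .Kinv) 1
  | Kinv_mul_K : Rel (gen .Kinv * gen .K) 1
  | EF : Rel (gen .E * gen .F - gen .F * gen .E) ((q - q⁻¹)⁻¹ • (gen .K - gen .Kinv))
  | KE : Rel (gen .K * gen .E) (q ^ 2 • (gen .E * gen .K))
  | KF : Rel (gen .K * gen .F) ((q ^ 2)⁻¹ • (gen .F * gen .K))

/-- The quantum group `𝐔 = U_q(𝔰𝔩₂)` over `ℚ(q)`. -/
abbrev U : Type := RingQuot Rel

/-- The generator `E`. -/
def E : U := RingQuot.mkAlgHom Qq Rel (gen .E)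
/-- The generator `F`. -/
def F : U := RingQuot.mkAlgHom Qq Rel (gen .F)
/-- The generator `K`. -/
def K : U := RingQuot.mkAlgHom Qq Rel (gen .K)
/-- The generator `K⁻¹`. -/
def Kinv : U := RingQuot.mkAlgHom Qq Rel (gen .Kinv)

/-- The divided power `E^{(n)} = E^n / [n]!`. -/
def Ediv (n : ℕ) : U := (qfact n)⁻¹ • E ^ n
/-- The divided power `F^{(n)} = F^n / [n]!`. -/
def Fdiv (n : ℕ) : U := (qfact n)⁻¹ • F ^ n

/-! ### The simple modules `L(μ)` -/

/-- The simple module `L(μ)` of highest weight `μ ∈ ℕ`. Its underlying `ℚ(q)`-space has the basis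
`e_0, …, e_μ`, with `K e_k = q^{μ-2k} e_k`, `F e_k = [k+1] e_{k+1}` and `E e_k = [μ-k+1] e_{k-1}`
(where `e_{-1} = e_{μ+1} = 0`). -/
def L (μ : ℕ) : Type := Fin (μ + 1) → Qq

instance (μ : ℕ) : AddCommGroup (L μ) := inferInstanceAs (AddCommGroup (Fin (μ + 1) → Qq))
instance (μ : ℕ) : Module Qq (L μ) := inferInstanceAs (Module Qq (Fin (μ + 1) → Qq))

/-- The action of `E` in coordinates. -/
def opE (μ : ℕ) : Module.End Qq (L μ) where
  toFun x := fun k => if h : (k : ℕ) + 1 < μ + 1 then qint (μ - k) * x ⟨k + 1, h⟩ else 0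
  map_add' x y := by
    funext k
    change _ = (dite ((k : ℕ) + 1 < μ + 1) _ _ : Qq) + dite ((k : ℕ) + 1 < μ + 1) _ _
    split_ifs with h
    · exact mul_add _ (x _) (y _)
    · simp
  map_smul' c x := by
    funext k
    change _ = c * (dite ((k : ℕ) + 1 < μ + 1) _ _ : Qq)
    split_ifs with h
    · exact mul_left_comm _ c (x _)
    · simp

/-- The action of `F` in coordinates. -/
def opF (μ : ℕ) : Module.End Qq (L μ) where
  toFun x := fun k => qint k * x ⟨k - 1, by omega⟩
  map_add' x y := by
    funext k
    exact mul_add _ (x _) (y _)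
  map_smul' c x := by
    funext k
    exact mul_left_comm _ c (x _)

/-- Multiplication of the `k`-th coordinate by `q^{s(μ-2k)}`; for `s = 1` this is the action of
`K`, for `s = -1` that of `K⁻¹`. -/
def opK (μ : ℕ) (s : ℤ) : Module.End Qq (L μ) where
  toFun x := fun k => q ^ (s * (μ - 2 * k)) * x k
  map_add' x y := by
    funext k
    exact mul_add _ (x _) (y _)
  map_smul' c x := by
    funext k
    exact mul_left_comm _ c (x _)

/-- The action of the generators. -/
def opGen (μ : ℕ) : Gen → Module.End Qq (L μ)
  | .E => opE μ
  | .F => opF μ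
  | .K => opK μ 1
  | .Kinv => opK μ (-1)

lemma q_pow_ne_one {n : ℕ} (hn : n ≠ 0) : q ^ n ≠ 1 := by
  intro h
  have h1 : algebraMap ℚ[X] Qq (X ^ n) = algebraMap ℚ[X] Qq 1 := by
    rw [map_pow, RatFunc.algebraMap_X, map_one]; exact h
  have h2 := congrArg natDegree (RatFunc.algebraMap_injective ℚ h1)
  simp at h2
  exact hn h2

lemma q_sub_inv_ne_zero : q - q⁻¹ ≠ 0 := by
  intro h
  have h1 := q_pow_ne_one (n := 2) (by norm_num)
  apply h1
  have h2 : q = q⁻¹ := sub_eq_zero.1 h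
  rw [pow_two]
  nth_rewrite 2 [h2]
  exact mul_inv_cancel₀ q_ne_zero

lemma qint_ne_zero {m : ℤ} (hm : 0 < m) : qint m ≠ 0 := by
  unfold qint
  refine div_ne_zero ?_ q_sub_inv_ne_zero
  obtain ⟨n, rfl⟩ := Int.eq_ofNat_of_zero_le hm.le
  intro h
  apply q_pow_ne_one (n := n + n) (by omega)
  have h2 := sub_eq_zero.1 h
  rw [zpow_neg, zpow_natCast] at h2
  rw [pow_add]
  nth_rewrite 2 [h2]
  exact mul_inv_cancel₀ (pow_ne_zero _ q_ne_zero)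

lemma qint_zero : qint 0 = 0 := by simp [qint]

lemma opE_apply (μ : ℕ) (x : L μ) (k : Fin (μ + 1)) (h : (k : ℕ) + 1 < μ + 1) :
    opE μ x k = qint (μ - k) * x ⟨k + 1, h⟩ := by
  change (dite ((k : ℕ) + 1 < μ + 1) _ _ : Qq) = _
  rw [dif_pos h]

lemma opE_apply_last (μ : ℕ) (x : L μ) (k : Fin (μ + 1)) (h : ¬ (k : ℕ) + 1 < μ + 1) :
    opE μ x k = 0 := by
  change (dite ((k : ℕ) + 1 < μ + 1) _ _ : Qq) = _
  rw [dif_neg h]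

lemma opF_apply (μ : ℕ) (x : L μ) (k : Fin (μ + 1)) :
    opF μ x k = qint k * x ⟨k - 1, by omega⟩ := rfl

lemma opK_apply (μ : ℕ) (s : ℤ) (x : L μ) (k : Fin (μ + 1)) :
    opK μ s x k = q ^ (s * (μ - 2 * k)) * x k := rfl

lemma opK_mul (μ : ℕ) (s : ℤ) : opK μ s * opK μ (-s) = 1 := by
  ext x
  funext k
  change q ^ (s * (μ - 2 * k)) * (q ^ (-s * (μ - 2 * k)) * x k) = x k
  rw [← mul_assoc, ← zpow_add₀ q_ne_zero]
  simp

lemma qint_comm_identity (a b : ℤ) :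
    qint a * qint (b + 1) - qint b * qint (a + 1) = qint (a - b) := by
  unfold qint
  have h0 := q_ne_zero
  have h1 := q_sub_inv_ne_zero
  rw [div_mul_div_comm, div_mul_div_comm, ← sub_div, div_eq_div_iff (mul_ne_zero h1 h1) h1]
  simp only [neg_add, sub_eq_add_neg, zpow_add₀ h0, zpow_neg, zpow_one, neg_neg]
  field_simp
  ring

/-- The representation of `𝐔` on `L(μ)`. -/
def rep (μ : ℕ) : U →ₐ[Qq] Module.End Qq (L μ) :=
  RingQuot.liftAlgHom Qq ⟨FreeAlgebra.lift Qq (opGen μ), by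
    intro x y h
    induction h with
    | K_mul_Kinv => simpa [opGen] using opK_mul μ 1
    | Kinv_mul_K => simpa [opGen] using opK_mul μ (-1)
    | EF =>
      simp only [map_sub, map_mul, map_smul, FreeAlgebra.lift_ι_apply, opGen]
      ext x
      funext k
      change opE μ (opF μ x) k - opF μ (opE μ x) k
        = (q - q⁻¹)⁻¹ * (opK μ 1 x k - opK μ (-1) x k)
      have hR : (q - q⁻¹)⁻¹ * (opK μ 1 x k - opK μ (-1) x k)
          = qint ((μ - k : ℤ) - k) * x k := by
        rw [opK_apply, opK_apply, qint, ← sub_mul, ← mul_assoc, div_eq_inv_mul]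
        congr 4 <;> ring
      have hFE : opF μ (opE μ x) k = qint k * qint ((μ - k : ℤ) + 1) * x k := by
        rw [opF_apply]
        rcases Nat.eq_zero_or_pos (k : ℕ) with h0 | h0
        · have hz : qint ((k : ℕ) : ℤ) = 0 := by rw [h0]; exact qint_zero
          rw [hz, zero_mul, zero_mul, zero_mul]
        · rw [opE_apply _ _ _ (by simp; omega), mul_assoc]
          congr 2
          · congr 1; simp only []; push_cast [h0]; ring
          · congr 1; ext; simp; omega
      have hEF : opE μ (opF μ x) k = qint (μ - k : ℤ) * qint (k + 1) * x k := by
        by_cases h : (k : ℕ) + 1 < μ + 1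
        · rw [opE_apply _ _ _ h, opF_apply, mul_assoc]
          congr 2
        · rw [opE_apply_last _ _ _ h]
          have : (μ : ℤ) - k = 0 := by omega
          rw [this, qint_zero]; simp
      rw [hR, hFE, hEF, ← sub_mul, qint_comm_identity]
    | KE =>
      simp only [map_mul, map_smul, FreeAlgebra.lift_ι_apply, opGen]
      ext x
      funext k
      change opK μ 1 (opE μ x) k = q ^ 2 * opE μ (opK μ 1 x) k
      rw [opK_apply]
      by_cases h : (k : ℕ) + 1 < μ + 1
      · rw [opE_apply _ _ _ h, opE_apply _ _ _ h, opK_apply]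
        have : q ^ (1 * ((μ : ℤ) - 2 * (k : ℕ)))
            = q ^ 2 * q ^ (1 * ((μ : ℤ) - 2 * ((k : ℕ) + 1 : ℕ))) := by
          rw [← zpow_natCast, ← zpow_add₀ q_ne_zero]
          congr 1; push_cast; ring
        rw [this]; ring
      · rw [opE_apply_last _ _ _ h, opE_apply_last _ _ _ h]; simp
    | KF =>
      simp only [map_mul, map_smul, FreeAlgebra.lift_ι_apply, opGen]
      ext x
      funext k
      change opK μ 1 (opF μ x) k = (q ^ 2)⁻¹ * opF μ (opK μ 1 x) k
      rw [opK_apply, opF_apply, opF_apply, opK_apply]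
      rcases Nat.eq_zero_or_pos (k : ℕ) with h0 | h0
      · have hz : qint ((k : ℕ) : ℤ) = 0 := by rw [h0]; exact qint_zero
        rw [hz, zero_mul, zero_mul, mul_zero, mul_zero]
      · have : q ^ (1 * ((μ : ℤ) - 2 * (k : ℕ)))
            = (q ^ 2)⁻¹ * q ^ (1 * ((μ : ℤ) - 2 * ((k : ℕ) - 1 : ℕ))) := by
          rw [← zpow_natCast, ← zpow_neg, ← zpow_add₀ q_ne_zero]
          congr 1; push_cast [h0]; ring
        rw [this]; ring⟩

instance (μ : ℕ) : Module U (L μ) := Module.compHom (L μ) (rep μ).toRingHom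

lemma smul_def (μ : ℕ) (u : U) (x : L μ) : u • x = rep μ u x := rfl

instance (μ : ℕ) : IsScalarTower Qq U (L μ) where
  smul_assoc c u x := by
    rw [smul_def, smul_def, map_smul]; rfl

lemma E_smul (μ : ℕ) (x : L μ) : E • x = opE μ x := by
  rw [smul_def, E, rep, RingQuot.liftAlgHom_mkAlgHom_apply, FreeAlgebra.lift_ι_apply]; rfl
lemma F_smul (μ : ℕ) (x : L μ) : F • x = opF μ x := by
  rw [smul_def, F, rep, RingQuot.liftAlgHom_mkAlgHom_apply, FreeAlgebra.lift_ι_apply]; rfl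
lemma K_smul (μ : ℕ) (x : L μ) : K • x = opK μ 1 x := by
  rw [smul_def, K, rep, RingQuot.liftAlgHom_mkAlgHom_apply, FreeAlgebra.lift_ι_apply]; rfl
lemma Kinv_smul (μ : ℕ) (x : L μ) : Kinv • x = opK μ (-1) x := by
  rw [smul_def, Kinv, rep, RingQuot.liftAlgHom_mkAlgHom_apply, FreeAlgebra.lift_ι_apply]; rfl

/-- The basis vector `e_k` of `L(μ)`. -/
def ebasis (μ : ℕ) (k : Fin (μ + 1)) : L μ := fun j => if j = k then 1 else 0

/-- The highest weight vector `v⁺_μ` of `L(μ)`. -/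
def vplus (μ : ℕ) : L μ := ebasis μ 0

lemma vplus_ne_zero (μ : ℕ) : vplus μ ≠ 0 := by
  intro h
  have h1 : (if (0 : Fin (μ + 1)) = 0 then (1 : Qq) else 0) = 0 := congrFun h 0
  rw [if_pos rfl] at h1
  exact one_ne_zero h1

/-- `v⁺_μ` is a highest weight vector ... -/
lemma E_smul_vplus (μ : ℕ) : E • vplus μ = 0 := by
  rw [E_smul]
  funext k
  by_cases h : (k : ℕ) + 1 < μ + 1
  · rw [opE_apply _ _ _ h]
    simp only [vplus, ebasis]
    rw [if_neg (fun h0 => Nat.succ_ne_zero (k : ℕ) (congrArg Fin.val h0)), mul_zero]; rfl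
  · rw [opE_apply_last _ _ _ h]; rfl

/-- ... of weight `μ`. -/
lemma K_smul_vplus (μ : ℕ) : K • vplus μ = q ^ μ • vplus μ := by
  rw [K_smul]
  funext k
  rw [opK_apply]
  change _ = q ^ μ * vplus μ k
  simp only [vplus, ebasis]
  split_ifs with h
  · have hk : ((k : ℕ) : ℤ) = 0 := by rw [h]; rfl
    rw [hk, mul_zero, sub_zero, one_mul, zpow_natCast]
  · rw [mul_zero, mul_zero]

lemma F_smul_ebasis (μ : ℕ) (k : ℕ) (h : k + 1 < μ + 1) :
    F • ebasis μ ⟨k, by omega⟩ = qint (k + 1) • ebasis μ ⟨k + 1, h⟩ := by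
  rw [F_smul]
  funext j
  rw [opF_apply]
  change _ = qint (k + 1) * ebasis μ ⟨k + 1, h⟩ j
  simp only [ebasis, Fin.ext_iff]
  by_cases hj : (j : ℕ) = k + 1
  · simp [hj]
  · rw [if_neg hj]
    rcases Nat.eq_zero_or_pos (j : ℕ) with h0 | h0
    · simp [h0, qint_zero]
    · rw [if_neg (by omega)]; simp

lemma ebasis_mem (μ : ℕ) (N : Submodule U (L μ)) (h0 : vplus μ ∈ N) (k : ℕ) (hk : k < μ + 1) :
    ebasis μ ⟨k, hk⟩ ∈ N := by
  induction k with
  | zero => exact h0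
  | succ k ih =>
    have h1 := N.smul_mem F (ih (by omega))
    rw [F_smul_ebasis μ k hk] at h1
    have h2 := N.smul_of_tower_mem (qint (k + 1))⁻¹ h1
    rwa [inv_smul_smul₀ (qint_ne_zero (by omega))] at h2

lemma eq_top_of_vplus_mem (μ : ℕ) (N : Submodule U (L μ)) (h0 : vplus μ ∈ N) : N = ⊤ := by
  rw [eq_top_iff]
  intro x _
  have hx : x = ∑ k : Fin (μ + 1), x k • ebasis μ k := by
    funext j
    have h1 : (∑ k : Fin (μ + 1), x k • ebasis μ k) j
        = ∑ k : Fin (μ + 1), x k * ebasis μ k j :=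
      Finset.sum_apply j Finset.univ (fun k : Fin (μ + 1) => x k • (ebasis μ k : Fin (μ + 1) → Qq))
    rw [h1]
    rw [Finset.sum_eq_single j]
    · simp only [ebasis, if_true, mul_one]
    · intro k _ hk
      simp only [ebasis]
      rw [if_neg hk.symm, mul_zero]
    · intro hj
      exact absurd (Finset.mem_univ j) hj
  rw [hx]
  exact N.sum_mem fun k _ => N.smul_of_tower_mem _ (ebasis_mem μ N h0 k k.2)

lemma vplus_mem_of_support (μ : ℕ) (N : Submodule U (L μ)) (n : ℕ) :
    ∀ x ∈ N, ∀ hn : n < μ + 1, x ⟨n, hn⟩ ≠ 0 → (∀ j : Fin (μ + 1), n < j → x j = 0) →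
      vplus μ ∈ N := by
  induction n with
  | zero =>
    intro x hx hn h0 hsupp
    have hx' : x = x ⟨0, hn⟩ • vplus μ := by
      funext j
      change x j = x ⟨0, hn⟩ * vplus μ j
      simp only [vplus, ebasis]
      split_ifs with h
      · subst h; simp
      · rw [hsupp j (Nat.pos_of_ne_zero (fun h1 => h (Fin.ext h1)))]; simp
    have h2 := N.smul_of_tower_mem (x ⟨0, hn⟩)⁻¹ hx
    rw [hx'] at h2
    have h3 : (x ⟨0, hn⟩ • vplus μ) ⟨0, hn⟩ = x ⟨0, hn⟩ := by rw [← hx']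
    rw [h3, inv_smul_smul₀ h0] at h2
    exact h2
  | succ n ih =>
    intro x hx hn h0 hsupp
    refine ih (E • x) (N.smul_mem E hx) (by omega) ?_ ?_
    · rw [E_smul, opE_apply _ _ _ (by simpa using hn)]
      exact mul_ne_zero (qint_ne_zero (by simp; omega)) h0
    · intro j hj
      rw [E_smul]
      by_cases h : (j : ℕ) + 1 < μ + 1
      · rw [opE_apply _ _ _ h, hsupp _ (by simpa using hj)]; simp
      · exact opE_apply_last _ _ _ h

/-- `L(μ)` is simple; together with `E_smul_vplus` and `K_smul_vplus` this says that it is the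
simple `𝐔`-module of highest weight `μ`. -/
instance isSimpleModule_L (μ : ℕ) : IsSimpleModule U (L μ) := by
  have : Nontrivial (L μ) := ⟨_, _, vplus_ne_zero μ⟩
  rw [isSimpleModule_iff]
  refine { eq_bot_or_eq_top := fun N => ?_ }
  classical
  by_cases hN : N = ⊥
  · exact Or.inl hN
  · right
    obtain ⟨x, hx, hx0⟩ := N.exists_mem_ne_zero_of_ne_bot hN
    have hne : (Finset.univ.filter fun k : Fin (μ + 1) => x k ≠ 0).Nonempty := by
      by_contra hcon
      rw [Finset.not_nonempty_iff_eq_empty, Finset.filter_eq_empty_iff] at hcon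
      apply hx0
      funext k
      exact not_not.1 (hcon (Finset.mem_univ k))
    obtain ⟨n, hn, hmax⟩ := Finset.exists_max_image _ (fun k : Fin (μ + 1) => (k : ℕ)) hne
    refine eq_top_of_vplus_mem μ N (vplus_mem_of_support μ N n x hx n.2 ?_ ?_)
    · simpa using hn
    · intro j hj
      by_contra hxj
      have := hmax j (by simpa using hxj)
      omega

/-! ### The coideal subalgebra and the `ı`-divided powers -/

/-- The element `𝔱 = q⁻¹ E K⁻¹ + F` of `𝐔`. -/
def tU : U := q⁻¹ • (E * Kinv) + F

/-- The coideal subalgebra `𝐔^ı = ℚ(q)[𝔱]` of `𝐔`. -/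
def Ui : Subalgebra Qq U := Algebra.adjoin Qq {tU}

/-- The element `𝔱`, as an element of `𝐔^ı`. -/
def t : Ui := ⟨tU, Algebra.subset_adjoin rfl⟩

/-- The polynomial `(x - [-2a+1]) (x - [-2a+3]) ⋯ (x - [2a-3]) (x - [2a-1])`, with `2a` factors. -/
def dvNum (a : ℕ) : Qq[X] :=
  ∏ i ∈ Finset.range (2 * a), (X - C (qint (-2 * a + 1 + 2 * i)))

/-- The `n`-th odd-weight `ı`-divided power as a polynomial. -/
def dvPoly (n : ℕ) : Qq[X] :=
  C (qfact n)⁻¹ * (if Even n then dvNum (n / 2) else X * dvNum (n / 2))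

/-- The odd-weight `ı`-divided power `𝔱^{(n)}_odd`, an element of `𝐔^ı`. -/
def dv (n : ℕ) : Ui := aeval t (dvPoly n)

/-! ### The `ı`-canonical basis of `L(μ)` -/

/-- `ψ` is the bar involution `ψ_ı` of `L(μ)`: it is semilinear for `q ↦ q⁻¹`, it fixes `v⁺_μ`, and
it is compatible with the bar involution of `𝐔^ı = ℚ(q)[𝔱]` (which fixes `𝔱` and sends `q` to
`q⁻¹`). -/
structure IsIotaBar (μ : ℕ) (ψ : L μ →ₛₗ[bar] L μ) : Prop where
  involutive : Function.Involutive ψ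
  map_t_smul : ∀ x : L μ, ψ (t • x) = t • ψ x
  map_vplus : ψ (vplus μ) = vplus μ

/-- The family `b_0, …, b_μ` is the `ı`-canonical basis of `L(μ)`: each `b_a` is fixed by `ψ_ı` and
lies in `F^{(a)} v⁺_μ + ∑_{0 ≤ r ≤ μ} q⁻¹ ℤ[q⁻¹] F^{(r)} v⁺_μ`. -/
def IsIotaCanonicalModule (μ : ℕ) (b : Fin (μ + 1) → L μ) : Prop :=
  ∃ ψ : L μ →ₛₗ[bar] L μ, IsIotaBar μ ψ ∧
    ∀ a, ψ (b a) = b a ∧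
      ∃ c : Fin (μ + 1) → Qq, (∀ r, c r ∈ negLattice) ∧
        b a = Fdiv a • vplus μ + ∑ r, c r • (Fdiv r • vplus μ)

/-! ### The `ı`-canonical basis of `𝐔^ı`, odd weights -/

/-- `Ψ` is the bar involution of `𝐔^ı`: the ring involution with `q ↦ q⁻¹` and `𝔱 ↦ 𝔱`. -/
structure IsIotaBarUi (Ψ : Ui →+* Ui) : Prop where
  involutive : Function.Involutive Ψ
  map_algebraMap : ∀ c : Qq, Ψ (algebraMap Qq Ui c) = algebraMap Qq Ui (bar c)
  map_t : Ψ t = t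

/-- The family `(u_n)` is the `ı`-canonical basis of `𝐔^ı` for odd weights: with respect to the
projective system of the modules `L(2l+1)`, the element `u_n` sends `v⁺_{2l+1}` to the `n`-th
element of the `ı`-canonical basis of `L(2l+1)` for all sufficiently large `l`. -/
def IsIotaCanonicalOdd (u : ℕ → Ui) : Prop :=
  ∀ n : ℕ, ∃ N : ℕ, ∀ l ≥ N, ∃ b : Fin (2 * l + 1 + 1) → L (2 * l + 1),
    IsIotaCanonicalModule (2 * l + 1) b ∧
      ∃ h : n < 2 * l + 1 + 1, u n • vplus (2 * l + 1) = b ⟨n, h⟩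

/-- The `𝒜`-subalgebra of `𝐔` generated by all divided powers `E^{(n)}` and `F^{(n)}`. -/
def dividedPowerAlgebra : Subalgebra intLaurent U :=
  Algebra.adjoin intLaurent (Set.range Ediv ∪ Set.range Fdiv)

/-- The summand `𝐔̇ 1_ν = 𝐔 / 𝐔 (K - q^ν)` of the modified quantum group, a left `𝐔`-module. -/
abbrev Udot (ν : ℤ) : Type := U ⧸ Submodule.span U {K - algebraMap Qq U (q ^ ν)}

/-- The idempotent `1_ν`, which generates `𝐔̇ 1_ν`. -/
def oneDot (ν : ℤ) : Udot ν := Submodule.Quotient.mk 1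

/-- The integral form of `𝐔̇ 1_ν`: the `𝒜`-span of all products of divided powers, applied
to `1_ν`. -/
def UdotInt (ν : ℤ) : Set (Udot ν) := {m | ∃ y ∈ dividedPowerAlgebra, m = y • oneDot ν}

/-- The odd-weight integral form of `𝐔^ı`: the elements of `𝐔^ı` that preserve the integral form
of `𝐔̇ 1_ν` for each odd `ν`. -/
def UiIntOdd : Set Ui := {x | ∀ ν : ℤ, Odd ν → ∀ m ∈ UdotInt ν, x • m ∈ UdotInt ν}

end IotaQuantum

end

/-!
# The `ı`-canonical bases for odd weights

The proof rests on a closed formula for the action of the `ı`-divided power `𝔱^{(n)} = 𝔱^{(n)}_odd` on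
a vector `v` of odd weight `2l + 1` in any `𝐔`-module: for `n = 2m` or `n = 2m + 1`,
`𝔱^{(n)} v = ∑_{a, c ≥ 0} α_{a,c} F^{(n - 2c - a)} E^{(a)} v`,
where `α_{a,c}` is a power of `q` times the Gaussian binomial coefficient `binom(l - m + a + c, c)` in
the variable `q⁻⁴` (`IsWeight.dv_smul_even`, `IsWeight.dv_smul_odd`). The `ı`-divided powers satisfy
`𝔱 𝔱^{(2m)} = [2m+1] 𝔱^{(2m+1)}` and `𝔱 𝔱^{(2m+1)} = [2m+2] 𝔱^{(2m+2)} + [2m+1] 𝔱^{(2m)}`, and `𝔱`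
acts on the `F^{(b)} E^{(a)} v` with three terms, so the formula amounts to two identities between
the coefficients (`oddCoeff_rec`, `evenCoeff_rec`).

On the highest weight vector `v⁺` of `L(2l+1)` only the terms with `a = 0` survive. Those with
`c ≥ 1` have coefficients in `q⁻¹ ℤ[q⁻¹]` when `n ≤ 2l + 1`, so the `𝔱^{(n)} v⁺` are unitriangular in
the `F^{(n)} v⁺` (`dv_smul_vplus_unitriangular`), and they vanish for `n > 2l + 1`. The coefficients
of the recursion are bar invariant, so the semilinear map that fixes all the `𝔱^{(n)} v⁺` is the bar
involution. No nonzero element of `q⁻¹ ℤ[q⁻¹]` is bar invariant (`eq_zero_of_bar_eq`), which gives the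
uniqueness of the `ı`-canonical basis (`isIotaCanonicalModule_iff`).

Since `L(2l+1)` detects the combinations of the `𝔱^{(n)}` with `n ≤ l`, the family `𝔱^{(n)}` is
linearly independent, `𝔱` is transcendental, and an element of `𝐔^ı` is determined by its action on
the `v⁺_{2l+1}` for large `l`. The Gaussian binomial coefficients are Laurent polynomials with integer
coefficients also where `l - m + a` is negative (`gauss_mem`), so the formula shows that `𝔱^{(n)}`
preserves the integral form of `𝐔̇ 1_ν` for all odd `ν` (`dv_mem_UiIntOdd`). Conversely, an element
with this property maps each `v⁺_{2l+1}` into the `ℤ[q, q⁻¹]`-lattice of the `F^{(r)} v⁺`, and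
unitriangularity gives the integrality of its coefficients (`span_intLaurent_dv`).
-/

noncomputable section

namespace IotaQuantum

open Polynomial

/-! ### Gaussian binomial coefficients -/

/-- The Gaussian binomial coefficient `binom(s + c, c)` in the variable `x`, for every integer `s`,
as the product of the `(1 - x^{s+i}) / (1 - x^i)` over `1 ≤ i ≤ c`. -/
def gauss (x : Qq) (s : ℤ) (c : ℕ) : Qq :=
  ∏ i ∈ Finset.range c, (1 - x ^ (s + i + 1)) / (1 - x ^ (i + 1))

lemma gauss_zero (x : Qq) (s : ℤ) : gauss x s 0 = 1 := by simp [gauss]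

lemma gauss_neg_one (x : Qq) (c : ℕ) : gauss x (-1) (c + 1) = 0 := by
  unfold gauss
  exact Finset.prod_eq_zero (Finset.mem_range.2 c.succ_pos) (by simp)

section gauss

variable {x : Qq} (hx : ∀ n : ℕ, n ≠ 0 → x ^ n ≠ 1)
include hx

lemma one_sub_pow_ne_zero (c : ℕ) : 1 - x ^ (c + 1) ≠ 0 :=
  sub_ne_zero.2 (hx _ c.succ_ne_zero).symm

lemma gauss_succ_mul (s : ℤ) (c : ℕ) :
    gauss x s (c + 1) * (1 - x ^ (c + 1)) = (1 - x ^ (s + c + 1)) * gauss x s c := by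
  have h := one_sub_pow_ne_zero hx c
  rw [gauss, Finset.prod_range_succ, ← gauss]
  field_simp

lemma gauss_pred_mul (s : ℤ) (c : ℕ) :
    gauss x (s - 1) (c + 1) * (1 - x ^ (c + 1)) = (1 - x ^ s) * gauss x s c := by
  have h := one_sub_pow_ne_zero hx c
  have e : ∀ i : ℕ, s - 1 + ((i + 1 : ℕ) : ℤ) + 1 = s + i + 1 := fun i => by push_cast; ring
  have e0 : s - 1 + ((0 : ℕ) : ℤ) + 1 = s := by simp
  rw [gauss, gauss, Finset.prod_div_distrib, Finset.prod_div_distrib, Finset.prod_range_succ',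
    Finset.prod_range_succ]
  simp only [e, e0]
  field_simp

lemma gauss_pascal (hx0 : x ≠ 0) (s : ℤ) (c : ℕ) :
    gauss x s (c + 1) = gauss x s c + x ^ (c + 1) * gauss x (s - 1) (c + 1) := by
  have h := one_sub_pow_ne_zero hx c
  apply mul_right_cancel₀ h
  rw [gauss_succ_mul hx, add_mul, mul_assoc, gauss_pred_mul hx, add_assoc, zpow_add₀ hx0]
  norm_cast
  ring

/-- For `s ≥ 0` the Gaussian binomial coefficient is a polynomial in `x` with integer
coefficients. -/
lemma gauss_mem_of_nonneg (hx0 : x ≠ 0) {R : Subalgebra ℤ Qq} (hR : x ∈ R) (c : ℕ) :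
    ∀ s : ℕ, gauss x s c ∈ R := by
  induction c with
  | zero => intro s; rw [gauss_zero]; exact one_mem R
  | succ c ih =>
    intro s
    induction s with
    | zero =>
      rw [gauss_pascal hx hx0]
      simp only [Nat.cast_zero, zero_sub, gauss_neg_one, mul_zero, add_zero]
      exact_mod_cast ih 0
    | succ s ihs =>
      rw [gauss_pascal hx hx0]
      refine add_mem (ih _) (mul_mem (pow_mem hR _) ?_)
      simpa using ihs

/-- For every `s` the Gaussian binomial coefficient is a Laurent polynomial in `x` with integer
coefficients. -/
lemma gauss_mem (hx0 : x ≠ 0) {R : Subalgebra ℤ Qq} (hR : x ∈ R) (hR' : x⁻¹ ∈ R) (c : ℕ) :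
    ∀ s : ℤ, gauss x s c ∈ R := by
  induction c with
  | zero => intro s; rw [gauss_zero]; exact one_mem R
  | succ c ih =>
    intro s
    induction s using Int.induction_on with
    | zero => exact_mod_cast gauss_mem_of_nonneg hx hx0 hR (c + 1) 0
    | succ i _ => exact_mod_cast gauss_mem_of_nonneg hx hx0 hR (c + 1) (i + 1)
    | pred i ihs =>
      -- the recursion in `s` is run downwards, which costs an inverse of `x ^ (c + 1)`
      have h : gauss x (-i - 1) (c + 1)
          = x⁻¹ ^ (c + 1) * (gauss x (-i) (c + 1) - gauss x (-i) c) := by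
        rw [gauss_pascal hx hx0 (-i), add_sub_cancel_left, ← mul_assoc, ← mul_pow,
          inv_mul_cancel₀ hx0, one_pow, one_mul]
      rw [h]
      exact mul_mem (pow_mem hR' _) (sub_mem ihs (ih _))

end gauss

lemma q_zpow_ne_one {m : ℤ} (hm : m ≠ 0) : q ^ m ≠ 1 := by
  rcases Int.natAbs_eq m with h | h
  · rw [h, zpow_natCast]
    exact q_pow_ne_one (by omega)
  · rw [h, zpow_neg, zpow_natCast]
    exact fun h1 => q_pow_ne_one (n := m.natAbs) (by omega) (inv_eq_one.1 h1)

lemma q_zpow_pow_ne_one {m : ℤ} (hm : m ≠ 0) (n : ℕ) (hn : n ≠ 0) : (q ^ m) ^ n ≠ 1 := by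
  rw [← zpow_natCast, ← zpow_mul]
  exact q_zpow_ne_one (mul_ne_zero hm (by exact_mod_cast hn))

lemma q_mem : q ∈ intLaurent := Algebra.subset_adjoin (by simp)

lemma q_inv_mem : q⁻¹ ∈ intLaurent := Algebra.subset_adjoin (by simp)

lemma q_zpow_mem (m : ℤ) : q ^ m ∈ intLaurent := by
  cases m with
  | ofNat n => simpa using pow_mem q_mem n
  | negSucc n => rw [zpow_negSucc, ← inv_pow]; exact pow_mem q_inv_mem _

lemma gauss_q_mem {m : ℤ} (hm : m ≠ 0) (s : ℤ) (c : ℕ) : gauss (q ^ m) s c ∈ intLaurent :=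
  gauss_mem (q_zpow_pow_ne_one hm) (zpow_ne_zero _ q_ne_zero) (q_zpow_mem m)
    (by rw [← zpow_neg]; exact q_zpow_mem _) c s

lemma qfact_ne_zero (n : ℕ) : qfact n ≠ 0 :=
  Finset.prod_ne_zero_iff.2 fun i _ => qint_ne_zero (by positivity)

lemma qfact_succ (n : ℕ) : qfact (n + 1) = qfact n * qint (n + 1) := by
  simp [qfact, Finset.prod_range_succ]

lemma qint_neg (m : ℤ) : qint (-m) = -qint m := by
  rw [qint, qint, neg_neg, ← neg_div, neg_sub]

/-- The quantum integer in terms of `q⁻²`, the variable in which quantum binomial coefficients are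
Gaussian ones. -/
lemma qint_eq (m : ℤ) : qint m = q ^ (m - 1) * (1 - (q ^ (-2 : ℤ)) ^ m) / (1 - q ^ (-2 : ℤ)) := by
  have h0 := q_ne_zero
  have h1 := q_sub_inv_ne_zero
  have h2 : 1 - q ^ (-2 : ℤ) ≠ 0 := sub_ne_zero.2 (q_zpow_ne_one (by norm_num)).symm
  rw [qint, div_eq_div_iff h1 h2, ← zpow_mul, zpow_sub₀ h0, neg_mul, two_mul, neg_add,
    zpow_add₀ h0, show (-2 : ℤ) = -1 + -1 by norm_num, zpow_add₀ h0]
  simp only [zpow_neg, zpow_one]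
  field_simp

/-- Quantum binomial coefficients, of any integer over a natural number, lie in `ℤ[q, q⁻¹]`. -/
lemma qbinom_mem (s : ℤ) (n : ℕ) :
    (qfact n)⁻¹ * ∏ i ∈ Finset.range n, qint (s + i + 1) ∈ intLaurent := by
  have h : (qfact n)⁻¹ * ∏ i ∈ Finset.range n, qint (s + i + 1)
      = (q ^ s) ^ n * gauss (q ^ (-2 : ℤ)) s n := by
    rw [qfact, ← Finset.prod_inv_distrib, ← Finset.prod_mul_distrib, gauss]
    conv_rhs => rw [← Finset.card_range n, ← Finset.prod_const, Finset.card_range,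
      ← Finset.prod_mul_distrib]
    refine Finset.prod_congr rfl fun i _ => ?_
    have h2 : 1 - q ^ (-2 : ℤ) ≠ 0 := sub_ne_zero.2 (q_zpow_ne_one (by norm_num)).symm
    have h3 := one_sub_pow_ne_zero (q_zpow_pow_ne_one (m := -2) (by norm_num)) i
    have h4 := zpow_ne_zero (i : ℤ) q_ne_zero
    rw [qint_eq, qint_eq, show s + i + 1 - 1 = s + i by ring, zpow_add₀ q_ne_zero s,
      show (i : ℤ) + 1 - 1 = i by ring,
      show ((i : ℤ) + 1) = ((i + 1 : ℕ) : ℤ) by push_cast; rfl, zpow_natCast _ (i + 1)]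
    generalize q ^ (-2 : ℤ) = y at *
    generalize y ^ (s + i + 1) = z
    field_simp
  rw [h]
  exact mul_mem (pow_mem (q_zpow_mem s) n) (gauss_q_mem (by norm_num) s n)

/-! ### The lattice `q⁻¹ ℤ[q⁻¹]` and the bar involution of `ℚ(q)` -/

lemma mem_negLattice_iff {c : Qq} : c ∈ negLattice ↔ q * c ∈ Algebra.adjoin ℤ {q⁻¹} := by
  rw [Algebra.adjoin_singleton_eq_range_aeval]
  constructor
  · rintro ⟨p, rfl⟩
    exact ⟨p, by rw [mul_inv_cancel_left₀ q_ne_zero]; rfl⟩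
  · rintro ⟨p, hp⟩
    refine ⟨p, ?_⟩
    change aeval q⁻¹ p = _ at hp
    rw [hp, inv_mul_cancel_left₀ q_ne_zero]

lemma negLattice_zero : (0 : Qq) ∈ negLattice := by simp [mem_negLattice_iff, zero_mem]

lemma negLattice_add {c d : Qq} (hc : c ∈ negLattice) (hd : d ∈ negLattice) :
    c + d ∈ negLattice := by
  rw [mem_negLattice_iff] at *
  rw [mul_add]
  exact add_mem hc hd

lemma negLattice_sub {c d : Qq} (hc : c ∈ negLattice) (hd : d ∈ negLattice) :
    c - d ∈ negLattice := by
  rw [mem_negLattice_iff] at *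
  rw [mul_sub]
  exact sub_mem hc hd

lemma negLattice_subset {c : Qq} (hc : c ∈ negLattice) : c ∈ intLaurent := by
  have h : Algebra.adjoin ℤ {q⁻¹} ≤ intLaurent := Algebra.adjoin_mono (by simp)
  have h1 := mul_mem q_inv_mem (h (mem_negLattice_iff.1 hc))
  rwa [inv_mul_cancel_left₀ q_ne_zero] at h1

lemma qq_ringHom_ext {f g : Qq →+* Qq} (h : f q = g q) : f = g := by
  refine IsFractionRing.ringHom_ext (A := ℚ[X]) fun p => ?_
  have h1 : f.comp (algebraMap ℚ[X] Qq) = g.comp (algebraMap ℚ[X] Qq) := by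
    refine Polynomial.ringHom_ext' (RingHom.ext_rat _ _) ?_
    simpa [RatFunc.algebraMap_X, q] using h
  exact RingHom.congr_fun h1 p

lemma bar_bar (c : Qq) : bar (bar c) = c := by
  have h : bar.comp bar = RingHom.id Qq := qq_ringHom_ext (by simp [bar_q])
  exact RingHom.congr_fun h c

lemma bar_qint (m : ℤ) : bar (qint m) = qint m := by
  have h := q_sub_inv_ne_zero
  have h' : q⁻¹ - q ≠ 0 := by rw [← neg_sub]; exact neg_ne_zero.2 h
  rw [qint, map_div₀, map_sub, map_sub, map_inv₀, map_zpow₀, map_zpow₀, bar_q, inv_inv,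
    inv_zpow', inv_zpow', neg_neg, ← neg_sub, ← neg_sub q, neg_div_neg_eq]

lemma bar_qfact (n : ℕ) : bar (qfact n) = qfact n := by
  simp [qfact, map_prod, bar_qint]

/-- A bar invariant element of `q⁻¹ ℤ[q⁻¹]` vanishes: it has only negative powers of `q`, and only
positive ones. -/
lemma eq_zero_of_bar_eq {c : Qq} (hc : c ∈ negLattice) (hb : bar c = c) : c = 0 := by
  obtain ⟨p, rfl⟩ := hc
  have hbar : bar (q⁻¹ * aeval q⁻¹ p) = q * aeval q p := by
    rw [map_mul, map_inv₀, bar_q, inv_inv]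
    congr 1
    have := (map_aeval_eq_aeval_map (φ := RingHom.id ℤ) (ψ := bar) (RingHom.ext_int _ _) p q⁻¹)
    rw [this, map_inv₀, bar_q, inv_inv, Polynomial.map_id]
  rw [hbar] at hb
  have hrev : aeval q⁻¹ p * q ^ p.natDegree = aeval q p.reverse := by
    let _ : Invertible q⁻¹ := ⟨q, mul_inv_cancel₀ q_ne_zero, inv_mul_cancel₀ q_ne_zero⟩
    have h : aeval q p.reverse * q⁻¹ ^ p.natDegree = aeval q⁻¹ p :=
      eval₂_reverse_mul_pow (algebraMap ℤ Qq) q⁻¹ p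
    rw [← h, mul_assoc, ← mul_pow, inv_mul_cancel₀ q_ne_zero, one_pow, mul_one]
  have hpoly : (X ^ (p.natDegree + 2) * p : ℤ[X]) = p.reverse := by
    have hinj : Function.Injective (aeval q : ℤ[X] →ₐ[ℤ] Qq) := by
      intro a b hab
      have h : ∀ a : ℤ[X], aeval q a = algebraMap ℚ[X] Qq (a.map (Int.castRingHom ℚ)) := by
        intro a
        induction a using Polynomial.induction_on' with
        | add a b ha hb => simp [ha, hb]
        | monomial n c =>
          simp [← C_mul_X_pow_eq_monomial, RatFunc.algebraMap_X, q]
      rw [h, h] at hab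
      exact map_injective _ Int.cast_injective (RatFunc.algebraMap_injective ℚ hab)
    apply hinj
    rw [map_mul, map_pow, aeval_X, ← hrev, pow_add]
    linear_combination (q ^ (p.natDegree + 1)) * hb
      + q ^ p.natDegree * aeval q⁻¹ p * mul_inv_cancel₀ q_ne_zero
  by_contra hne
  have hp : p ≠ 0 := by rintro rfl; simp at hne
  have h1 := congrArg natDegree hpoly
  rw [natDegree_X_pow_mul _ hp] at h1
  have := p.reverse_natDegree_le
  omega

/-! ### The coefficients of the `ı`-divided powers -/

/-- The coefficient of `F^{(2m - 2c - a)} E^{(a)}` in the even `ı`-divided power `𝔱^{(2m)}_odd`, acting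
on vectors of weight `2l + 1`. -/
def evenCoeff (l m a : ℤ) (c : ℕ) : Qq :=
  q ^ (a * (2 * m - 2 * l - 1 - 2 * a) - 2 * a * c - c * (2 * c + 1))
    * gauss (q ^ (-4 : ℤ)) (l - m + a) c

/-- The coefficient of `F^{(2m + 1 - 2c - a)} E^{(a)}` in the odd `ı`-divided power `𝔱^{(2m+1)}_odd`,
acting on vectors of weight `2l + 1`. -/
def oddCoeff (l m a : ℤ) (c : ℕ) : Qq :=
  q ^ (a * (2 * m - 2 * l - 2 * a) - 2 * a * c - c * (2 * c - 1))
    * gauss (q ^ (-4 : ℤ)) (l - m + a) c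

/-- The family `f` moved one step up, with value `0` at `0`. -/
def shift (f : ℕ → Qq) : ℕ → Qq
  | 0 => 0
  | c + 1 => f c

lemma evenCoeff_mem (l m a : ℤ) (c : ℕ) : evenCoeff l m a c ∈ intLaurent :=
  mul_mem (q_zpow_mem _) (gauss_q_mem (by norm_num) _ _)

lemma oddCoeff_mem (l m a : ℤ) (c : ℕ) : oddCoeff l m a c ∈ intLaurent :=
  mul_mem (q_zpow_mem _) (gauss_q_mem (by norm_num) _ _)

lemma q_zpow_two_mul (m : ℤ) : q ^ (2 * m) = (q ^ m) ^ 2 := by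
  rw [mul_comm, zpow_mul]; rfl

lemma q_zpow_four_mul (m : ℤ) : q ^ (4 * m) = (q ^ m) ^ 4 := by
  rw [mul_comm, zpow_mul]; rfl

lemma q_neg_four_zpow (s : ℤ) : (q ^ (-4 : ℤ)) ^ s = ((q ^ s) ^ 4)⁻¹ := by
  rw [← zpow_mul, neg_mul, zpow_neg, q_zpow_four_mul]

/-- The three Gaussian binomial coefficients that meet in one step of the recursion, as multiples of
one and the same quantity. -/
lemma exists_gauss_four (s : ℤ) (c : ℕ) : ∃ W : Qq,
    gauss (q ^ (-4 : ℤ)) s (c + 1) = (1 - ((q ^ (s + c + 1)) ^ 4)⁻¹) * W ∧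
    gauss (q ^ (-4 : ℤ)) (s - 1) (c + 1) = (1 - ((q ^ s) ^ 4)⁻¹) * W ∧
    gauss (q ^ (-4 : ℤ)) s c = (1 - ((q ^ (c + 1 : ℤ)) ^ 4)⁻¹) * W := by
  have hx := q_zpow_pow_ne_one (m := -4) (by norm_num)
  have h := one_sub_pow_ne_zero hx c
  have e : (q ^ (-4 : ℤ)) ^ (c + 1) = ((q ^ (c + 1 : ℤ)) ^ 4)⁻¹ := by
    rw [← q_neg_four_zpow, ← zpow_natCast]; norm_cast
  refine ⟨gauss (q ^ (-4 : ℤ)) s c / (1 - (q ^ (-4 : ℤ)) ^ (c + 1)), ?_, ?_, ?_⟩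
  · rw [← q_neg_four_zpow, ← mul_div_assoc, eq_div_iff h, gauss_succ_mul hx]
  · rw [← q_neg_four_zpow, ← mul_div_assoc, eq_div_iff h, gauss_pred_mul hx]
  · rw [← e, mul_div_cancel₀ _ h]

/-- The recursion of the coefficients that comes from `𝔱 𝔱^{(2m)} = [2m+1] 𝔱^{(2m+1)}`. The three
terms on the right come from `F F^{(b)}`, from `F^{(b)} E E^{(a-1)}`, and from the commutator of `E`
with `F^{(b)}`. -/
lemma oddCoeff_rec (l m a : ℤ) (c : ℕ) :
    qint (2 * m + 1) * oddCoeff l m a c =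
      qint (2 * m + 1 - 2 * c - a) * evenCoeff l m a c
      + q ^ (-1 - (2 * l + 1 + 2 * (a - 1) - 2 * (2 * m + 1 - 2 * c - a)))
        * (qint a * evenCoeff l m (a - 1) c)
      + shift (fun c => q ^ (-1 - (2 * l + 1 + 2 * a - 2 * (2 * m - 2 * c - a)))
        * (qint (2 * l + 1 + 2 * a - (2 * m - 2 * c - a) + 1) * evenCoeff l m a c)) c := by
  have h0 := q_ne_zero
  have h1 := q_sub_inv_ne_zero
  cases c with
  | zero =>
    simp only [shift, oddCoeff, evenCoeff, gauss_zero, mul_one, add_zero, Nat.cast_zero, mul_zero,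
      sub_zero, zero_mul]
    generalize hE : a * (2 * m - 2 * l - 2 * a) = e
    rw [show a * (2 * m - 2 * l - 1 - 2 * a) = e - a by rw [← hE]; ring,
      show (a - 1) * (2 * m - 2 * l - 1 - 2 * (a - 1)) = e - 2 * m + 2 * l + 4 * a - a - 1 by
        rw [← hE]; ring]
    simp only [qint, neg_add, neg_sub, mul_add, mul_sub, zpow_add₀ h0, zpow_sub₀ h0,
      q_zpow_two_mul, q_zpow_four_mul, zpow_neg, mul_one, zpow_ofNat]
    have hu := zpow_ne_zero l h0
    have hy := zpow_ne_zero m h0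
    have hz := zpow_ne_zero a h0
    generalize q ^ l = u at *
    generalize q ^ m = y at *
    generalize q ^ a = z at *
    generalize q ^ e = w at *
    generalize q = Q at *
    field_simp
    ring
  | succ c =>
    obtain ⟨W, hW1, hW2, hW3⟩ := exists_gauss_four (l - m + a) c
    simp only [shift, oddCoeff, evenCoeff]
    rw [show l - m + (a - 1) = l - m + a - 1 by ring, hW1, hW2, hW3]
    push_cast
    generalize hE : a * (2 * m - 2 * l - 2 * a) - 2 * a * (c + 1) - c * (2 * c) = e
    rw [show a * (2 * m - 2 * l - 2 * a) - 2 * a * (c + 1) - (c + 1) * (2 * (c + 1) - 1)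
        = e - 2 * c - c - 1 by rw [← hE]; ring,
      show a * (2 * m - 2 * l - 1 - 2 * a) - 2 * a * (c + 1) - (c + 1) * (2 * (c + 1) + 1)
        = e - a - 4 * c - c - 3 by rw [← hE]; ring,
      show (a - 1) * (2 * m - 2 * l - 1 - 2 * (a - 1)) - 2 * (a - 1) * (c + 1)
        - (c + 1) * (2 * (c + 1) + 1) = e + 2 * l + 2 * a - 2 * m + a - 2 * c - c - 2 by
        rw [← hE]; ring,
      show a * (2 * m - 2 * l - 1 - 2 * a) - 2 * a * c - c * (2 * c + 1)
        = e + a - c by rw [← hE]; ring]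
    simp only [qint, neg_add, neg_sub, mul_add, mul_sub, zpow_add₀ h0, zpow_sub₀ h0,
      q_zpow_two_mul, q_zpow_four_mul, zpow_neg, mul_one, zpow_ofNat]
    have hu := zpow_ne_zero l h0
    have hy := zpow_ne_zero m h0
    have hz := zpow_ne_zero a h0
    have hk := zpow_ne_zero (c : ℤ) h0
    generalize q ^ l = u at *
    generalize q ^ m = y at *
    generalize q ^ a = z at *
    generalize q ^ (c : ℤ) = k at *
    generalize q ^ e = w at *
    generalize q = Q at *
    field_simp
    ring

/-- The recursion of the coefficients that comes from
`𝔱 𝔱^{(2m+1)} = [2m+2] 𝔱^{(2m+2)} + [2m+1] 𝔱^{(2m)}`. -/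
lemma evenCoeff_rec (l m a : ℤ) (c : ℕ) :
    qint (2 * m + 2) * evenCoeff l (m + 1) a c =
      qint (2 * m + 2 - 2 * c - a) * oddCoeff l m a c
      + q ^ (-1 - (2 * l + 1 + 2 * (a - 1) - 2 * (2 * m + 2 - 2 * c - a)))
        * (qint a * oddCoeff l m (a - 1) c)
      + shift (fun c => q ^ (-1 - (2 * l + 1 + 2 * a - 2 * (2 * m + 1 - 2 * c - a)))
        * (qint (2 * l + 1 + 2 * a - (2 * m + 1 - 2 * c - a) + 1) * oddCoeff l m a c)) c
      - qint (2 * m + 1) * shift (evenCoeff l m a) c := by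
  have h0 := q_ne_zero
  have h1 := q_sub_inv_ne_zero
  cases c with
  | zero =>
    simp only [shift, oddCoeff, evenCoeff, gauss_zero, mul_one, add_zero, Nat.cast_zero, mul_zero,
      sub_zero, zero_mul]
    generalize hE : a * (2 * m - 2 * l - 2 * a) = e
    rw [show a * (2 * (m + 1) - 2 * l - 1 - 2 * a) = e + a by rw [← hE]; ring,
      show (a - 1) * (2 * m - 2 * l - 2 * (a - 1)) = e - 2 * m + 2 * l + 4 * a - 2 by
        rw [← hE]; ring]
    simp only [qint, neg_add, neg_sub, mul_add, mul_sub, zpow_add₀ h0, zpow_sub₀ h0,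
      q_zpow_two_mul, q_zpow_four_mul, zpow_neg, mul_one, zpow_ofNat]
    have hu := zpow_ne_zero l h0
    have hy := zpow_ne_zero m h0
    have hz := zpow_ne_zero a h0
    generalize q ^ l = u at *
    generalize q ^ m = y at *
    generalize q ^ a = z at *
    generalize q ^ e = w at *
    generalize q = Q at *
    field_simp
    ring
  | succ c =>
    obtain ⟨W, hW1, hW2, hW3⟩ := exists_gauss_four (l - m + a) c
    simp only [shift, oddCoeff, evenCoeff]
    rw [show l - m + (a - 1) = l - m + a - 1 by ring, show l - (m + 1) + a = l - m + a - 1 by ring,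
      hW1, hW2, hW3]
    push_cast
    generalize hE : a * (2 * m - 2 * l - 2 * a) - 2 * a * (c + 1) - c * (2 * c) = e
    rw [show a * (2 * m - 2 * l - 2 * a) - 2 * a * (c + 1) - (c + 1) * (2 * (c + 1) - 1)
        = e - 2 * c - c - 1 by rw [← hE]; ring,
      show a * (2 * (m + 1) - 2 * l - 1 - 2 * a) - 2 * a * (c + 1) - (c + 1) * (2 * (c + 1) + 1)
        = e + a - 4 * c - c - 3 by rw [← hE]; ring,
      show (a - 1) * (2 * m - 2 * l - 2 * (a - 1)) - 2 * (a - 1) * (c + 1)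
        - (c + 1) * (2 * (c + 1) - 1) = e + 2 * l + 4 * a - 2 * m - c - 1 by
        rw [← hE]; ring,
      show a * (2 * m - 2 * l - 2 * a) - 2 * a * c - c * (2 * c - 1)
        = e + 2 * a + c by rw [← hE]; ring,
      show a * (2 * m - 2 * l - 1 - 2 * a) - 2 * a * c - c * (2 * c + 1)
        = e + a - c by rw [← hE]; ring]
    simp only [qint, neg_add, neg_sub, mul_add, mul_sub, zpow_add₀ h0, zpow_sub₀ h0,
      q_zpow_two_mul, q_zpow_four_mul, zpow_neg, mul_one, zpow_ofNat]
    have hu := zpow_ne_zero l h0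
    have hy := zpow_ne_zero m h0
    have hz := zpow_ne_zero a h0
    have hk := zpow_ne_zero (c : ℤ) h0
    generalize q ^ l = u at *
    generalize q ^ m = y at *
    generalize q ^ a = z at *
    generalize q ^ (c : ℤ) = k at *
    generalize q ^ e = w at *
    generalize q = Q at *
    field_simp
    ring

/-! ### The recursion of the `ı`-divided powers -/

lemma dvNum_succ (a : ℕ) : dvNum (a + 1) = dvNum a * (X ^ 2 - C (qint (2 * a + 1)) ^ 2) := by
  have e0 : -2 * ((a + 1 : ℕ) : ℤ) + 1 + 2 * ((0 : ℕ) : ℤ) = -(2 * a + 1) := by push_cast; ring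
  have e1 : -2 * ((a + 1 : ℕ) : ℤ) + 1 + 2 * ((2 * a + 1 : ℕ) : ℤ) = 2 * a + 1 := by
    push_cast; ring
  have e2 : ∀ i : ℕ, -2 * ((a + 1 : ℕ) : ℤ) + 1 + 2 * ((i + 1 : ℕ) : ℤ) = -2 * a + 1 + 2 * i :=
    fun i => by push_cast; ring
  rw [dvNum, show 2 * (a + 1) = 2 * a + 1 + 1 by ring, Finset.prod_range_succ, e1,
    Finset.prod_range_succ', e0]
  simp only [e2]
  rw [← dvNum, qint_neg, C_neg]
  ring

lemma dvPoly_even (m : ℕ) : dvPoly (2 * m) = C (qfact (2 * m))⁻¹ * dvNum m := by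
  simp [dvPoly]

lemma dvPoly_odd (m : ℕ) : dvPoly (2 * m + 1) = C (qfact (2 * m + 1))⁻¹ * (X * dvNum m) := by
  rw [dvPoly, if_neg (by simp), show (2 * m + 1) / 2 = m by omega]

/-- The recursion of the `ı`-divided powers, from an even one to an odd one. -/
lemma X_mul_dvPoly_even (m : ℕ) :
    X * dvPoly (2 * m) = C (qint (2 * m + 1)) * dvPoly (2 * m + 1) := by
  have h := qint_ne_zero (m := 2 * (m : ℤ) + 1) (by positivity)
  rw [dvPoly_even, dvPoly_odd, ← mul_assoc (C (qint _)), ← C_mul, qfact_succ]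
  push_cast
  rw [mul_inv, mul_left_comm (qint _), mul_inv_cancel₀ h, mul_one, mul_left_comm]

/-- The recursion of the `ı`-divided powers, from an odd one to an even one. The factors
`x - [2m+1]` and `x + [2m+1]` that enter combine to `x² - [2m+1]²`. -/
lemma X_mul_dvPoly_odd (m : ℕ) :
    X * dvPoly (2 * m + 1) =
      C (qint (2 * m + 2)) * dvPoly (2 * (m + 1)) + C (qint (2 * m + 1)) * dvPoly (2 * m) := by
  have h1 := qint_ne_zero (m := 2 * (m : ℤ) + 1) (by positivity)
  have h2 := qint_ne_zero (m := 2 * (m : ℤ) + 1 + 1) (by positivity)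
  have e1 : C (qint (2 * m + 2)) * C (qfact (2 * (m + 1)))⁻¹ = C (qfact (2 * m + 1))⁻¹ := by
    rw [show 2 * (m + 1) = 2 * m + 1 + 1 by ring, qfact_succ, ← C_mul]
    push_cast
    rw [show (2 * m + 2 : ℤ) = 2 * m + 1 + 1 by ring, mul_inv, mul_left_comm,
      mul_inv_cancel₀ h2, mul_one]
  have e2 : C (qfact (2 * m))⁻¹ = C (qint (2 * m + 1)) * C (qfact (2 * m + 1))⁻¹ := by
    rw [qfact_succ, ← C_mul]
    push_cast
    rw [mul_inv, mul_left_comm, mul_inv_cancel₀ h1, mul_one]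
  rw [dvPoly_even, dvPoly_even, dvPoly_odd, dvNum_succ, ← mul_assoc (C (qint _)), e1, e2]
  ring

lemma t_mul_dv_even (m : ℕ) : t * dv (2 * m) = qint (2 * m + 1) • dv (2 * m + 1) := by
  have h := congrArg (aeval t) (X_mul_dvPoly_even m)
  rwa [map_mul, map_mul, aeval_X, aeval_C, ← Algebra.smul_def] at h

lemma t_mul_dv_odd (m : ℕ) :
    t * dv (2 * m + 1) = qint (2 * m + 2) • dv (2 * (m + 1)) + qint (2 * m + 1) • dv (2 * m) := by
  have h := congrArg (aeval t) (X_mul_dvPoly_odd m)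
  rwa [map_mul, map_add, map_mul, map_mul, aeval_X, aeval_C, aeval_C, ← Algebra.smul_def,
    ← Algebra.smul_def] at h

lemma dv_zero : dv 0 = 1 := by
  simp [dv, dvPoly, dvNum, qfact]

/-! ### Divided powers on a weight vector -/

lemma F_mul_Fdiv (n : ℕ) : F * Fdiv n = qint (n + 1) • Fdiv (n + 1) := by
  have h := qint_ne_zero (m := (n : ℤ) + 1) (by positivity)
  rw [Fdiv, Fdiv, qfact_succ, smul_smul, mul_inv, mul_left_comm, mul_inv_cancel₀ h, mul_one,
    mul_smul_comm, ← pow_succ']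

lemma E_mul_Ediv (n : ℕ) : E * Ediv n = qint (n + 1) • Ediv (n + 1) := by
  have h := qint_ne_zero (m := (n : ℤ) + 1) (by positivity)
  rw [Ediv, Ediv, qfact_succ, smul_smul, mul_inv, mul_left_comm, mul_inv_cancel₀ h, mul_one,
    mul_smul_comm, ← pow_succ']

lemma Fdiv_zero : Fdiv 0 = 1 := by simp [Fdiv, qfact]

lemma Ediv_zero : Ediv 0 = 1 := by simp [Ediv, qfact]

lemma K_mul_Kinv : K * Kinv = 1 := by
  rw [K, Kinv, ← map_mul, RingQuot.mkAlgHom_rel Qq Rel.K_mul_Kinv, map_one]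

lemma Kinv_mul_K : Kinv * K = 1 := by
  rw [K, Kinv, ← map_mul, RingQuot.mkAlgHom_rel Qq Rel.Kinv_mul_K, map_one]

lemma E_mul_F : E * F = F * E + (q - q⁻¹)⁻¹ • (K - Kinv) := by
  have h := RingQuot.mkAlgHom_rel Qq Rel.EF
  rw [map_sub, map_mul, map_mul, map_smul, map_sub] at h
  exact sub_eq_iff_eq_add'.1 h

lemma K_mul_E : K * E = q ^ 2 • (E * K) := by
  have h := RingQuot.mkAlgHom_rel Qq Rel.KE
  rwa [map_mul, map_smul, map_mul] at h

lemma K_mul_F : K * F = (q ^ 2)⁻¹ • (F * K) := by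
  have h := RingQuot.mkAlgHom_rel Qq Rel.KF
  rwa [map_mul, map_smul, map_mul] at h

/-- The vector `F^{(b)} E^{(a)} v`, with value `0` for `b < 0`. -/
def fe {M : Type*} [AddCommGroup M] [Module U M] (v : M) (b : ℤ) (a : ℕ) : M := if 0 ≤ b then Fdiv b.toNat • Ediv a • v else 0

lemma fe_natCast {M : Type*} [AddCommGroup M] [Module U M] (v : M) (b a : ℕ) : fe v b a = Fdiv b • Ediv a • v := by simp [fe]

lemma fe_of_neg {M : Type*} [AddCommGroup M] [Module U M] (v : M) {b : ℤ} (hb : b < 0) (a : ℕ) : fe v b a = 0 := by simp [fe, hb]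

section weight

variable {M : Type*} [AddCommGroup M] [Module Qq M] [Module U M] [IsScalarTower Qq U M]

/-- The vector `v` of a `𝐔`-module has weight `κ`, or is zero. -/
def IsWeight (κ : ℤ) (v : M) : Prop := K • v = q ^ κ • v

lemma IsWeight.kinv {κ : ℤ} {v : M} (hv : IsWeight κ v) : Kinv • v = q ^ (-κ) • v := by
  have h : Kinv • K • v = v := by rw [← mul_smul, Kinv_mul_K, one_smul]
  rw [hv, smul_comm] at h
  rw [zpow_neg]
  exact (eq_inv_smul_iff₀ (zpow_ne_zero _ q_ne_zero)).2 h

lemma IsWeight.smul {κ : ℤ} {v : M} (hv : IsWeight κ v) (c : Qq) : IsWeight κ (c • v) := by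
  rw [IsWeight, smul_comm, hv, smul_comm]

lemma IsWeight.E_smul {κ : ℤ} {v : M} (hv : IsWeight κ v) : IsWeight (κ + 2) (E • v) := by
  rw [IsWeight, ← mul_smul, K_mul_E, smul_assoc, mul_smul, hv, smul_comm E, smul_smul,
    zpow_add₀ q_ne_zero, mul_comm]
  rfl

lemma IsWeight.F_smul {κ : ℤ} {v : M} (hv : IsWeight κ v) : IsWeight (κ - 2) (F • v) := by
  rw [IsWeight, ← mul_smul, K_mul_F, smul_assoc, mul_smul, hv, smul_comm F, smul_smul,
    zpow_sub₀ q_ne_zero, mul_comm, div_eq_mul_inv]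
  rfl

lemma IsWeight.E_pow_smul {κ : ℤ} {v : M} (hv : IsWeight κ v) (n : ℕ) :
    IsWeight (κ + 2 * n) (E ^ n • v) := by
  induction n with
  | zero => simpa using hv
  | succ n ih =>
    have h := ih.E_smul
    rw [← mul_smul, ← pow_succ', add_assoc] at h
    push_cast
    rwa [mul_add]

lemma IsWeight.F_pow_smul {κ : ℤ} {v : M} (hv : IsWeight κ v) (n : ℕ) :
    IsWeight (κ - 2 * n) (F ^ n • v) := by
  induction n with
  | zero => simpa using hv
  | succ n ih =>
    have h := ih.F_smul
    rw [← mul_smul, ← pow_succ', sub_sub] at h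
    push_cast
    rwa [mul_add]

lemma IsWeight.Ediv_smul {κ : ℤ} {v : M} (hv : IsWeight κ v) (n : ℕ) :
    IsWeight (κ + 2 * n) (Ediv n • v) := by
  rw [Ediv, smul_assoc]
  exact (hv.E_pow_smul n).smul _

lemma IsWeight.Fdiv_smul {κ : ℤ} {v : M} (hv : IsWeight κ v) (n : ℕ) :
    IsWeight (κ - 2 * n) (Fdiv n • v) := by
  rw [Fdiv, smul_assoc]
  exact (hv.F_pow_smul n).smul _

lemma IsWeight.E_smul_F {κ : ℤ} {v : M} (hv : IsWeight κ v) :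
    E • F • v = F • E • v + qint κ • v := by
  rw [← mul_smul, E_mul_F, add_smul, mul_smul, smul_assoc, sub_smul, hv, hv.kinv, ← sub_smul,
    smul_smul (q - q⁻¹)⁻¹, qint, div_eq_inv_mul]

lemma IsWeight.E_smul_F_pow {κ : ℤ} {v : M} (hv : IsWeight κ v) (n : ℕ) :
    E • F ^ (n + 1) • v =
      F ^ (n + 1) • E • v
        + (qint (n + 1) * qint (κ - n)) • F ^ n • v := by
  induction n with
  | zero =>
    have h1 : qint 1 = 1 := by simp [qint, div_self q_sub_inv_ne_zero]
    simp [hv.E_smul_F, h1]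
  | succ n ih =>
    rw [pow_succ' _ (n + 1), mul_smul, (hv.F_pow_smul (n + 1)).E_smul_F, ih, smul_add, smul_comm _ (_ * _),
      ← mul_smul _ (_ ^ (n + 1)), ← mul_smul _ (_ ^ n), ← pow_succ', ← pow_succ', add_assoc,
      ← add_smul]
    congr 2
    have h := qint_comm_identity (κ - (n + 1)) (n + 1)
    push_cast
    rw [show κ - 2 * ((n : ℤ) + 1) = κ - (n + 1) - (n + 1) by ring, ← h,
      show κ - ((n : ℤ) + 1) + 1 = κ - n by ring]
    ring

lemma IsWeight.E_smul_Fdiv {κ : ℤ} {v : M} (hv : IsWeight κ v) (n : ℕ) :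
    E • Fdiv (n + 1) • v =
      Fdiv (n + 1) • E • v + qint (κ - n) • Fdiv n • v := by
  have h := qint_ne_zero (m := (n : ℤ) + 1) (by positivity)
  rw [Fdiv, Fdiv, smul_assoc, smul_comm, hv.E_smul_F_pow, smul_add,
    smul_assoc, smul_assoc, smul_smul, smul_smul, qfact_succ, mul_inv, mul_assoc (qfact n)⁻¹,
    inv_mul_cancel_left₀ h, mul_comm _ (qint _), mul_smul (qint _)]

lemma IsWeight.tU_smul {κ : ℤ} {v : M} (hv : IsWeight κ v) :
    tU • v = F • v + q ^ (-1 - κ) • E • v := by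
  rw [tU, add_smul, smul_assoc, mul_smul, hv.kinv, smul_comm E, smul_smul, add_comm,
    sub_eq_add_neg, zpow_add₀ q_ne_zero, zpow_neg_one]

lemma IsWeight.tU_smul_fe {κ : ℤ} {v : M} (hv : IsWeight κ v) (b : ℤ) (a : ℕ) :
    tU • fe v b a = qint (b + 1) • fe v (b + 1) a
      + q ^ (-1 - (κ + 2 * a - 2 * b)) •
        (qint (a + 1) • fe v b (a + 1) + qint (κ + 2 * a - b + 1) • fe v (b - 1) a) := by
  rcases lt_or_ge b 0 with hb | hb
  · rw [fe_of_neg v hb, fe_of_neg v hb, fe_of_neg v (show b - 1 < 0 by omega)]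
    rcases eq_or_ne b (-1) with rfl | h
    · simp [qint_zero]
    · simp [fe_of_neg v (show b + 1 < 0 by omega)]
  · obtain ⟨b, rfl⟩ := Int.eq_ofNat_of_zero_le hb
    have hF : F • fe v b a = qint (b + 1) • fe v (b + 1) a := by
      have e : (b : ℤ) + 1 = (b + 1 : ℕ) := by push_cast; rfl
      rw [fe_natCast, ← mul_smul, F_mul_Fdiv, smul_assoc, e, fe_natCast]
    have hw : IsWeight (κ + 2 * a - 2 * b) (fe v b a) := by
      rw [fe_natCast]
      exact (hv.Ediv_smul a).Fdiv_smul b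
    rw [hw.tU_smul, hF]
    congr 2
    have hE : Fdiv b • E • Ediv a • v = qint (a + 1) • fe v b (a + 1) := by
      rw [← mul_smul E, E_mul_Ediv, smul_assoc, smul_comm, fe_natCast]
    rw [fe_natCast, ← hE]
    cases b with
    | zero => rw [fe_of_neg v (by simp)]; simp [Fdiv_zero]
    | succ b =>
      have e : ((b + 1 : ℕ) : ℤ) - 1 = b := by push_cast; ring
      rw [(hv.Ediv_smul a).E_smul_Fdiv, e, fe_natCast]
      congr 3
      push_cast
      ring

end weight

/-! ### Expansion of the `ı`-divided powers on a weight vector -/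

/-- The sum of the `f(a, c) F^{(n - 2c - a)} E^{(a)} v` over `a, c < N`. As soon as `N > n` all
the terms with `n - 2c - a ≥ 0` are present. -/
def expansion {M : Type*} [AddCommGroup M] [Module Qq M] [Module U M] (v : M)
    (f : ℤ → ℕ → Qq) (N : ℕ) (n : ℤ) : M :=
  ∑ a ∈ Finset.range N, ∑ c ∈ Finset.range N, f a c • fe v (n - 2 * c - a) a

lemma sum_range_succ_shift {M : Type*} [AddCommGroup M] (g : ℕ → M) (N : ℕ) (h0 : g 0 = 0)
    (hN : g N = 0) : ∑ i ∈ Finset.range N, g (i + 1) = ∑ i ∈ Finset.range N, g i := by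
  have h := Finset.sum_range_succ' g N
  rw [Finset.sum_range_succ, h0, hN, add_zero, add_zero] at h
  exact h.symm

lemma smul_expansion {M : Type*} [AddCommGroup M] [Module Qq M] [Module U M]
    (c : Qq) (v : M) (f : ℤ → ℕ → Qq) (N : ℕ) (n : ℤ) :
    c • expansion v f N n = expansion v (fun a i => c * f a i) N n := by
  simp only [expansion, Finset.smul_sum, smul_smul]

lemma expansion_sub {M : Type*} [AddCommGroup M] [Module Qq M] [Module U M]
    (v : M) (f g : ℤ → ℕ → Qq) (N : ℕ) (n : ℤ) :
    expansion v f N n - expansion v g N n = expansion v (fun a i => f a i - g a i) N n := by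
  simp only [expansion, sub_smul, Finset.sum_sub_distrib]

lemma expansion_shift {M : Type*} [AddCommGroup M] [Module Qq M] [Module U M]
    (v : M) (f : ℤ → ℕ → Qq) {N : ℕ} {n : ℤ} (hN : n + 2 < N) :
    expansion v f N n = expansion v (fun a => shift (f a)) N (n + 2) := by
  refine Finset.sum_congr rfl fun a _ => ?_
  rw [← sum_range_succ_shift (fun c : ℕ => shift (f a) c • fe v (n + 2 - 2 * c - a) a)]
  · refine Finset.sum_congr rfl fun c _ => ?_
    simp only [shift]
    push_cast
    rw [show n + 2 - 2 * ((c : ℤ) + 1) - a = n - 2 * c - a by ring]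
  · simp [shift]
  · rw [fe_of_neg v (by omega), smul_zero]

section expansion

variable {M : Type*} [AddCommGroup M] [Module Qq M] [Module U M] [IsScalarTower Qq U M]

lemma IsWeight.tU_smul_expansion {κ : ℤ} {v : M} (hv : IsWeight κ v) (f : ℤ → ℕ → Qq) {N : ℕ}
    {n : ℤ} (hN : n + 1 < N) :
    tU • expansion v f N n = expansion v (fun a c =>
      qint (n + 1 - 2 * c - a) * f a c
      + q ^ (-1 - (κ + 2 * (a - 1) - 2 * (n + 1 - 2 * c - a))) * (qint a * f (a - 1) c)
      + shift (fun c => q ^ (-1 - (κ + 2 * a - 2 * (n - 2 * c - a)))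
        * (qint (κ + 2 * a - (n - 2 * c - a) + 1) * f a c)) c) N (n + 1) := by
  have h1 : ∀ a c : ℕ, f a c • qint (n - 2 * c - a + 1) • fe v (n - 2 * c - a + 1) a
      = (qint (n + 1 - 2 * c - a) * f a c) • fe v (n + 1 - 2 * c - a) a := fun a c => by
    rw [smul_smul, mul_comm, show n - 2 * c - a + 1 = n + 1 - 2 * c - a by ring]
  have h2 : ∀ c : ℕ, ∑ a ∈ Finset.range N, f a c •
        q ^ (-1 - (κ + 2 * a - 2 * (n - 2 * c - a))) • qint (a + 1) • fe v (n - 2 * c - a) (a + 1)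
      = ∑ a ∈ Finset.range N,
        (q ^ (-1 - (κ + 2 * ((a : ℤ) - 1) - 2 * (n + 1 - 2 * c - a)))
          * (qint a * f ((a : ℤ) - 1) c)) • fe v (n + 1 - 2 * c - a) a := fun c => by
    rw [← sum_range_succ_shift (fun a : ℕ => (q ^ (-1 - (κ + 2 * ((a : ℤ) - 1)
      - 2 * (n + 1 - 2 * c - a))) * (qint a * f ((a : ℤ) - 1) c)) • fe v (n + 1 - 2 * c - a) a)]
    · refine Finset.sum_congr rfl fun a _ => ?_
      push_cast
      rw [smul_smul, smul_smul, add_sub_cancel_right,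
        show n + 1 - 2 * (c : ℤ) - (a + 1) = n - 2 * c - a by ring]
      congr 1
      ring
    · simp [qint_zero]
    · rw [fe_of_neg v (by omega), smul_zero]
  have h3 : ∀ a : ℕ, ∑ c ∈ Finset.range N, f a c • q ^ (-1 - (κ + 2 * a - 2 * (n - 2 * c - a))) •
        qint (κ + 2 * a - (n - 2 * c - a) + 1) • fe v (n - 2 * c - a - 1) a
      = ∑ c ∈ Finset.range N, shift (fun c => q ^ (-1 - (κ + 2 * a - 2 * (n - 2 * c - a)))
        * (qint (κ + 2 * a - (n - 2 * c - a) + 1) * f a c)) c • fe v (n + 1 - 2 * c - a) a :=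
      fun a => by
    rw [← sum_range_succ_shift (fun c : ℕ => shift (fun c => q ^ (-1 - (κ + 2 * a - 2 * (n - 2 * c
      - a))) * (qint (κ + 2 * a - (n - 2 * c - a) + 1) * f a c)) c • fe v (n + 1 - 2 * c - a) a)]
    · refine Finset.sum_congr rfl fun c _ => ?_
      simp only [shift]
      push_cast
      rw [smul_smul, smul_smul,
        show n + 1 - 2 * ((c : ℤ) + 1) - a = n - 2 * c - a - 1 by ring]
      congr 1
      ring
    · simp [shift]
    · rw [fe_of_neg v (by omega), smul_zero]
  simp only [expansion, Finset.smul_sum, smul_comm tU (_ : Qq), hv.tU_smul_fe, smul_add, add_smul,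
    Finset.sum_add_distrib, h1, h3]
  rw [Finset.sum_comm (f := fun a c : ℕ => f a c • q ^ (-1 - (κ + 2 * (a : ℤ) - 2 * (n - 2 * c - a)))
    • qint (a + 1) • fe v (n - 2 * c - a) (a + 1)), Finset.sum_congr rfl fun c _ => h2 c,
    add_assoc]
  congr 2
  exact Finset.sum_comm

lemma tU_smul_dv_even (m : ℕ) (v : M) :
    tU • dv (2 * m) • v = qint (2 * m + 1) • dv (2 * m + 1) • v := by
  have h := congrArg (fun x : Ui => (x : U) • v) (t_mul_dv_even m)
  simp only [MulMemClass.coe_mul, mul_smul, SetLike.val_smul, smul_assoc] at h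
  exact h

lemma tU_smul_dv_odd (m : ℕ) (v : M) :
    tU • dv (2 * m + 1) • v =
      qint (2 * m + 2) • dv (2 * (m + 1)) • v + qint (2 * m + 1) • dv (2 * m) • v := by
  have h := congrArg (fun x : Ui => (x : U) • v) (t_mul_dv_odd m)
  simp only [MulMemClass.coe_mul, mul_smul, AddMemClass.coe_add, SetLike.val_smul, smul_assoc,
    add_smul] at h
  exact h

/-- The action of an even `ı`-divided power on a vector of odd weight determines that of the next,
odd one. -/
lemma IsWeight.dv_smul_odd_of_even {l : ℤ} {v : M} (hv : IsWeight (2 * l + 1) v) (m : ℕ)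
    (h : ∀ N : ℕ, 2 * m < N → dv (2 * m) • v = expansion v (evenCoeff l m) N (2 * m : ℕ))
    (N : ℕ) (hN : 2 * m + 1 < N) :
    dv (2 * m + 1) • v = expansion v (oddCoeff l m) N (2 * m + 1 : ℕ) := by
  have h0 := qint_ne_zero (m := 2 * (m : ℤ) + 1) (by positivity)
  have h1 := tU_smul_dv_even m v
  rw [h N (by omega), hv.tU_smul_expansion _ (by push_cast; omega)] at h1
  apply smul_right_injective M h0
  simp only
  rw [← h1, smul_expansion]
  push_cast
  congr 1
  funext a c
  rw [oddCoeff_rec]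

/-- The action of the even `ı`-divided powers on a vector of odd weight. -/
lemma IsWeight.dv_smul_even {l : ℤ} {v : M} (hv : IsWeight (2 * l + 1) v) (m : ℕ) :
    ∀ N : ℕ, 2 * m < N → dv (2 * m) • v = expansion v (evenCoeff l m) N (2 * m : ℕ) := by
  induction m with
  | zero =>
    intro N hN
    rw [mul_zero, dv_zero, one_smul, expansion, Finset.sum_eq_single_of_mem 0 (by simpa using hN),
      Finset.sum_eq_single_of_mem 0 (by simpa using hN)]
    · simp [evenCoeff, gauss_zero, fe, Fdiv_zero, Ediv_zero]
    · intro c _ hc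
      rw [fe_of_neg v (by simp; omega), smul_zero]
    · intro a _ ha
      refine Finset.sum_eq_zero fun c _ => ?_
      rw [fe_of_neg v (by simp; omega), smul_zero]
  | succ m ih =>
    intro N hN
    have h0 := qint_ne_zero (m := 2 * (m : ℤ) + 2) (by positivity)
    have h1 := tU_smul_dv_odd m v
    rw [ih N (by omega), hv.dv_smul_odd_of_even m ih N (by omega),
      hv.tU_smul_expansion _ (by push_cast; omega), smul_expansion,
      expansion_shift v (fun a i => _ * evenCoeff l m a i) (by push_cast; omega), ← sub_eq_iff_eq_add] at h1
    apply smul_right_injective M h0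
    simp only
    rw [← h1, smul_expansion]
    push_cast
    rw [show 2 * ((m : ℤ) + 1) = 2 * m + 2 by ring, show 2 * (m : ℤ) + 1 + 1 = 2 * m + 2 by ring,
      expansion_sub]
    congr 1
    funext a c
    rw [evenCoeff_rec]
    congr 1
    cases c <;> simp [shift]

/-- The action of the odd `ı`-divided powers on a vector of odd weight. -/
lemma IsWeight.dv_smul_odd {l : ℤ} {v : M} (hv : IsWeight (2 * l + 1) v) (m : ℕ) :
    ∀ N : ℕ, 2 * m + 1 < N →
      dv (2 * m + 1) • v = expansion v (oddCoeff l m) N (2 * m + 1 : ℕ) :=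
  hv.dv_smul_odd_of_even m (hv.dv_smul_even m)

end expansion

/-! ### The integral form of `𝐔̇ 1_ν` -/

lemma Ediv_mem (n : ℕ) : Ediv n ∈ dividedPowerAlgebra :=
  Algebra.subset_adjoin (Or.inl ⟨n, rfl⟩)

lemma Fdiv_mem (n : ℕ) : Fdiv n ∈ dividedPowerAlgebra :=
  Algebra.subset_adjoin (Or.inr ⟨n, rfl⟩)

/-- The elements of the integral form of `𝐔` that move weights by a fixed even amount. -/
def homogeneous : Submonoid U where
  carrier := {y | y ∈ dividedPowerAlgebra ∧ ∃ k : ℤ, K * y = q ^ (2 * k) • (y * K)}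
  one_mem' := ⟨one_mem _, 0, by simp⟩
  mul_mem' := by
    rintro y z ⟨hy, k, hk⟩ ⟨hz, j, hj⟩
    refine ⟨mul_mem hy hz, k + j, ?_⟩
    rw [← mul_assoc, hk, smul_mul_assoc, mul_assoc, hj, mul_smul_comm, smul_smul, mul_assoc,
      mul_add, zpow_add₀ q_ne_zero]

lemma K_mul_E_pow (n : ℕ) : K * E ^ n = q ^ (2 * (n : ℤ)) • (E ^ n * K) := by
  induction n with
  | zero => simp
  | succ n ih =>
    rw [pow_succ, ← mul_assoc, ih, smul_mul_assoc, mul_assoc, K_mul_E, mul_smul_comm, smul_smul,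
      mul_assoc]
    push_cast
    rw [mul_add, zpow_add₀ q_ne_zero]
    rfl

lemma K_mul_F_pow (n : ℕ) : K * F ^ n = q ^ (2 * (-n : ℤ)) • (F ^ n * K) := by
  induction n with
  | zero => simp
  | succ n ih =>
    rw [pow_succ, ← mul_assoc, ih, smul_mul_assoc, mul_assoc, K_mul_F, mul_smul_comm, smul_smul,
      mul_assoc]
    push_cast
    rw [neg_add, mul_add, zpow_add₀ q_ne_zero, show (2 * -1 : ℤ) = -(2 : ℕ) by norm_num, zpow_neg,
      zpow_natCast]

lemma mem_span_homogeneous {y : U} (hy : y ∈ dividedPowerAlgebra) :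
    y ∈ Submodule.span intLaurent (homogeneous : Set U) := by
  have h : dividedPowerAlgebra ≤ Algebra.adjoin intLaurent (homogeneous : Set U) := by
    refine Algebra.adjoin_mono ?_
    rintro _ (⟨n, rfl⟩ | ⟨n, rfl⟩)
    · refine ⟨Ediv_mem n, n, ?_⟩
      rw [Ediv, mul_smul_comm, K_mul_E_pow, smul_mul_assoc, smul_comm]
    · refine ⟨Fdiv_mem n, -n, ?_⟩
      rw [Fdiv, mul_smul_comm, K_mul_F_pow, smul_mul_assoc, smul_comm]
  have h1 := h hy
  rwa [← Subalgebra.mem_toSubmodule, Algebra.adjoin_eq_span, Submonoid.closure_eq] at h1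

lemma oneDot_isWeight (ν : ℤ) : IsWeight ν (oneDot ν) := by
  change (Submodule.Quotient.mk (K • (1 : U)) : Udot ν)
    = Submodule.Quotient.mk (q ^ ν • (1 : U))
  rw [Submodule.Quotient.eq, smul_eq_mul, mul_one, ← Algebra.algebraMap_eq_smul_one]
  exact Submodule.mem_span_singleton_self _

lemma UdotInt_add {ν : ℤ} {m m' : Udot ν} (hm : m ∈ UdotInt ν) (hm' : m' ∈ UdotInt ν) :
    m + m' ∈ UdotInt ν := by
  obtain ⟨y, hy, rfl⟩ := hm
  obtain ⟨y', hy', rfl⟩ := hm'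
  exact ⟨y + y', add_mem hy hy', (add_smul _ _ _).symm⟩

lemma UdotInt_zero (ν : ℤ) : (0 : Udot ν) ∈ UdotInt ν := ⟨0, zero_mem _, (zero_smul _ _).symm⟩

lemma UdotInt_smul {ν : ℤ} {m : Udot ν} (hm : m ∈ UdotInt ν) {c : Qq} (hc : c ∈ intLaurent) :
    c • m ∈ UdotInt ν := by
  obtain ⟨y, hy, rfl⟩ := hm
  refine ⟨c • y, ?_, (smul_assoc _ _ _).symm⟩
  exact dividedPowerAlgebra.smul_mem hy (⟨c, hc⟩ : intLaurent)

lemma UdotInt_sum {ν : ℤ} {ι : Type} (s : Finset ι) (g : ι → Udot ν)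
    (h : ∀ i ∈ s, g i ∈ UdotInt ν) : ∑ i ∈ s, g i ∈ UdotInt ν :=
  Finset.sum_induction g (· ∈ UdotInt ν) (fun _ _ => UdotInt_add) (UdotInt_zero ν) h

lemma UdotInt_mul {ν : ℤ} {m : Udot ν} (hm : m ∈ UdotInt ν) {y : U}
    (hy : y ∈ dividedPowerAlgebra) : y • m ∈ UdotInt ν := by
  obtain ⟨z, hz, rfl⟩ := hm
  exact ⟨y * z, mul_mem hy hz, (mul_smul _ _ _).symm⟩

lemma fe_mem_UdotInt {ν : ℤ} {m : Udot ν} (hm : m ∈ UdotInt ν) (b : ℤ) (a : ℕ) :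
    fe m b a ∈ UdotInt ν := by
  unfold fe
  split_ifs
  · exact UdotInt_mul (UdotInt_mul hm (Ediv_mem _)) (Fdiv_mem _)
  · exact UdotInt_zero ν

lemma expansion_mem_UdotInt {ν : ℤ} {m : Udot ν} (hm : m ∈ UdotInt ν) {f : ℤ → ℕ → Qq}
    (hf : ∀ a c, f a c ∈ intLaurent) (N : ℕ) (n : ℤ) : expansion m f N n ∈ UdotInt ν :=
  UdotInt_sum _ _ fun _ _ => UdotInt_sum _ _ fun _ _ => UdotInt_smul (fe_mem_UdotInt hm _ _) (hf _ _)

/-- An `ı`-divided power preserves the integral form of `𝐔̇ 1_ν` for odd `ν`: on the vectors of a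
fixed weight, which is odd, it acts by an integral combination of the `F^{(b)} E^{(a)}`. -/
lemma dv_mem_UiIntOdd (n : ℕ) : dv n ∈ UiIntOdd := by
  rintro ν ⟨l, rfl⟩ _ ⟨y, hy, rfl⟩
  refine Submodule.span_induction (p := fun y _ => dv n • y • oneDot (2 * l + 1) ∈
    UdotInt (2 * l + 1)) ?_ ?_ ?_ ?_ (mem_span_homogeneous hy)
  · rintro y ⟨hy, k, hk⟩
    have hm : y • oneDot (2 * l + 1) ∈ UdotInt (2 * l + 1) := ⟨y, hy, rfl⟩
    have hw : IsWeight (2 * (l + k) + 1) (y • oneDot (2 * l + 1)) := by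
      rw [IsWeight, ← mul_smul, hk, smul_assoc, mul_smul, oneDot_isWeight, smul_comm y, smul_smul,
        ← zpow_add₀ q_ne_zero]
      congr 2
      ring
    obtain ⟨m, rfl | rfl⟩ := n.even_or_odd'
    · rw [hw.dv_smul_even m _ (Nat.lt_succ_self _)]
      exact expansion_mem_UdotInt hm (fun a c => evenCoeff_mem _ _ a c) _ _
    · rw [hw.dv_smul_odd m _ (Nat.lt_succ_self _)]
      exact expansion_mem_UdotInt hm (fun a c => oddCoeff_mem _ _ a c) _ _
  · rw [zero_smul, smul_zero]
    exact UdotInt_zero _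
  · intro y z _ _ hy hz
    rw [add_smul, smul_add]
    exact UdotInt_add hy hz
  · intro c y _ hy
    have h : dv n • (c • y) • oneDot (2 * l + 1) = (c : Qq) • dv n • y • oneDot (2 * l + 1) := by
      change (dv n : U) • ((c : Qq) • y) • oneDot (2 * l + 1) = _
      rw [smul_assoc, smul_comm]
      rfl
    rw [h]
    exact UdotInt_smul hy c.2

/-! ### Coordinates on `L(μ)` -/

lemma L_add_apply {μ : ℕ} (x y : L μ) (k : Fin (μ + 1)) : (x + y) k = x k + y k := rfl

lemma L_sub_apply {μ : ℕ} (x y : L μ) (k : Fin (μ + 1)) : (x - y) k = x k - y k := rfl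

lemma L_zero_apply {μ : ℕ} (k : Fin (μ + 1)) : (0 : L μ) k = 0 := rfl

lemma L_smul_apply {μ : ℕ} (c : Qq) (x : L μ) (k : Fin (μ + 1)) : (c • x) k = c * x k := rfl

lemma L_sum_apply {μ : ℕ} {ι : Type} (s : Finset ι) (g : ι → L μ) (k : Fin (μ + 1)) :
    (∑ i ∈ s, g i) k = ∑ i ∈ s, g i k :=
  Finset.sum_apply k s (fun i => (g i : Fin (μ + 1) → Qq))

lemma F_pow_smul_apply {μ : ℕ} (n : ℕ) (x : L μ) (k : Fin (μ + 1)) :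
    (F ^ n • x) k = if n ≤ (k : ℕ) then
      (∏ i ∈ Finset.range n, qint (k - n + i + 1)) * x ⟨k - n, by omega⟩ else 0 := by
  induction n generalizing k with
  | zero => simp
  | succ n ih =>
    rw [pow_succ', mul_smul, F_smul, opF_apply, ih]
    simp only
    rcases Nat.eq_zero_or_pos (k : ℕ) with h | h
    · have h0 : qint ((k : ℕ) : ℤ) = 0 := by rw [h]; exact qint_zero
      rw [if_neg (show ¬ n + 1 ≤ (k : ℕ) by omega), h0, zero_mul]
    · by_cases hn : n + 1 ≤ (k : ℕ)
      · rw [if_pos hn, if_pos (by omega), Finset.prod_range_succ, mul_comm _ (qint _), mul_assoc]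
        congr 1
        · congr 1; push_cast; ring
        · congr 1
          · refine Finset.prod_congr rfl fun i _ => ?_
            congr 1
            push_cast [h]
            ring
          · congr 2; omega
      · rw [if_neg hn, if_neg (by omega), mul_zero]

lemma E_pow_smul_apply {μ : ℕ} (n : ℕ) (x : L μ) (k : Fin (μ + 1)) :
    (E ^ n • x) k = if h : (k : ℕ) + n < μ + 1 then
      (∏ i ∈ Finset.range n, qint (μ - k - n + i + 1)) * x ⟨k + n, h⟩ else 0 := by
  induction n generalizing k with
  | zero => simp [k.2]
  | succ n ih =>
    rw [pow_succ', mul_smul, E_smul]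
    by_cases hk : (k : ℕ) + 1 < μ + 1
    · rw [opE_apply _ _ _ hk, ih]
      simp only
      by_cases hn : (k : ℕ) + (n + 1) < μ + 1
      · rw [dif_pos hn, dif_pos (by omega), Finset.prod_range_succ, mul_comm _ (qint _), mul_assoc]
        congr 1
        · congr 1; push_cast; ring
        · congr 1
          · refine Finset.prod_congr rfl fun i _ => ?_
            congr 1
            push_cast
            ring
          · congr 2; omega
      · rw [dif_neg hn, dif_neg (by omega), mul_zero]
    · rw [opE_apply_last _ _ _ hk, dif_neg (by omega)]

lemma Fdiv_smul_vplus_apply {μ : ℕ} (n : ℕ) (k : Fin (μ + 1)) :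
    (Fdiv n • vplus μ) k = if n = (k : ℕ) then 1 else 0 := by
  rw [Fdiv, smul_assoc, L_smul_apply, F_pow_smul_apply]
  simp only [vplus, ebasis, Fin.ext_iff]
  rcases lt_trichotomy n (k : ℕ) with h | h | h
  · rw [if_pos h.le, if_neg h.ne, if_neg (by simp; omega), mul_zero, mul_zero]
  · have h1 : (∏ i ∈ Finset.range n, qint ((k : ℕ) - n + i + 1)) = qfact n := by
      rw [qfact, h]
      exact Finset.prod_congr rfl fun i _ => by rw [sub_self, zero_add]
    rw [if_pos h.le, if_pos h, if_pos (by simp; omega), h1, mul_one,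
      inv_mul_cancel₀ (qfact_ne_zero n)]
  · rw [if_neg (by omega), if_neg (by omega), mul_zero]

lemma Ediv_smul_vplus {μ : ℕ} {n : ℕ} (hn : n ≠ 0) : Ediv n • vplus μ = 0 := by
  obtain ⟨n, rfl⟩ := Nat.exists_eq_succ_of_ne_zero hn
  rw [Ediv, smul_assoc, pow_succ, mul_smul, E_smul_vplus, smul_zero, smul_zero]

/-- The integral form of `𝐔` preserves the lattice of the vectors of `L(μ)` with coordinates in
`ℤ[q, q⁻¹]`. -/
lemma dividedPowerAlgebra_smul_apply_mem {μ : ℕ} {y : U} (hy : y ∈ dividedPowerAlgebra) :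
    ∀ x : L μ, (∀ k, x k ∈ intLaurent) → ∀ k, (y • x) k ∈ intLaurent := by
  induction hy using Algebra.adjoin_induction with
  | mem y hy =>
    intro x hx k
    rcases hy with ⟨n, rfl⟩ | ⟨n, rfl⟩
    · rw [Ediv, smul_assoc, L_smul_apply, E_pow_smul_apply]
      split_ifs
      · rw [← mul_assoc]
        exact mul_mem (qbinom_mem _ n) (hx _)
      · rw [mul_zero]; exact zero_mem _
    · rw [Fdiv, smul_assoc, L_smul_apply, F_pow_smul_apply]
      split_ifs
      · rw [← mul_assoc]
        exact mul_mem (qbinom_mem _ n) (hx _)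
      · rw [mul_zero]; exact zero_mem _
  | algebraMap c =>
    intro x hx k
    have h : algebraMap intLaurent U c • x = (c : Qq) • x := by
      rw [Algebra.algebraMap_eq_smul_one]
      change ((c : Qq) • (1 : U)) • x = _
      rw [smul_assoc, one_smul]
    rw [h, L_smul_apply]
    exact mul_mem c.2 (hx k)
  | add y z _ _ hy hz =>
    intro x hx k
    rw [add_smul, L_add_apply]
    exact add_mem (hy x hx k) (hz x hx k)
  | mul y z _ _ hy hz =>
    intro x hx k
    rw [mul_smul]
    exact hy _ (hz x hx) k

/-! ### The `ı`-divided powers on the highest weight vector -/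

lemma vplus_isWeight (l : ℕ) : IsWeight (2 * l + 1) (vplus (2 * l + 1)) := by
  rw [IsWeight, K_smul_vplus]
  norm_cast

lemma expansion_vplus_apply {μ : ℕ} (f : ℤ → ℕ → Qq) (N : ℕ) (n : ℤ) (k : Fin (μ + 1)) :
    expansion (vplus μ) f (N + 1) n k = f 0 0 * (if n = k then 1 else 0)
      + ∑ c ∈ Finset.range N, f 0 (c + 1) * (if n - 2 * (c + 1) = k then 1 else 0) := by
  have h0 : ∀ b : ℤ, fe (vplus μ) b 0 k = if b = k then 1 else 0 := by
    intro b
    rcases lt_or_ge b 0 with hb | hb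
    · rw [fe_of_neg _ hb, if_neg (by omega)]; rfl
    · obtain ⟨b, rfl⟩ := Int.eq_ofNat_of_zero_le hb
      rw [fe_natCast, Ediv_zero, one_smul, Fdiv_smul_vplus_apply]
      simp
  rw [expansion, Finset.sum_eq_single_of_mem 0 (by simp), L_sum_apply, Finset.sum_range_succ']
  · simp [L_smul_apply, h0, add_comm]
  · intro a _ ha
    refine Finset.sum_eq_zero fun c _ => ?_
    have : fe (vplus μ) (n - 2 * c - a) a = 0 := by
      unfold fe
      split_ifs
      · rw [Ediv_smul_vplus ha, smul_zero]
      · rfl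
    rw [this, smul_zero]

lemma zpow_mem_adjoin_q_inv {e : ℤ} (he : e ≤ 0) : q ^ e ∈ Algebra.adjoin ℤ {q⁻¹} := by
  obtain ⟨n, hn⟩ := Int.eq_ofNat_of_zero_le (neg_nonneg.2 he)
  rw [← neg_neg e, hn, zpow_neg, zpow_natCast, ← inv_pow]
  exact pow_mem (Algebra.self_mem_adjoin_singleton _ _) n

lemma zpow_mul_gauss_mem_negLattice {e s : ℤ} (he : e < 0) (hs : 0 ≤ s) (c : ℕ) :
    q ^ e * gauss (q ^ (-4 : ℤ)) s c ∈ negLattice := by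
  obtain ⟨s, rfl⟩ := Int.eq_ofNat_of_zero_le hs
  rw [mem_negLattice_iff, ← mul_assoc, ← zpow_one_add₀ q_ne_zero]
  exact mul_mem (zpow_mem_adjoin_q_inv (by omega))
    (gauss_mem_of_nonneg (q_zpow_pow_ne_one (by norm_num)) (zpow_ne_zero _ q_ne_zero)
      (zpow_mem_adjoin_q_inv (by norm_num)) c s)

lemma evenCoeff_mem_negLattice {l m : ℤ} (h : m ≤ l) (c : ℕ) :
    evenCoeff l m 0 (c + 1) ∈ negLattice := by
  refine zpow_mul_gauss_mem_negLattice ?_ (by omega) _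
  push_cast
  nlinarith

lemma oddCoeff_mem_negLattice {l m : ℤ} (h : m ≤ l) (c : ℕ) :
    oddCoeff l m 0 (c + 1) ∈ negLattice := by
  refine zpow_mul_gauss_mem_negLattice ?_ (by omega) _
  push_cast
  nlinarith

lemma evenCoeff_zero (l m : ℤ) : evenCoeff l m 0 0 = 1 := by simp [evenCoeff, gauss_zero]

lemma oddCoeff_zero (l m : ℤ) : oddCoeff l m 0 0 = 1 := by simp [oddCoeff, gauss_zero]

lemma expansion_vplus_unitriangular {μ : ℕ} {f : ℤ → ℕ → Qq} (hf0 : f 0 0 = 1)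
    (hf : ∀ c, f 0 (c + 1) ∈ negLattice) (N n : ℕ) (k : Fin (μ + 1)) :
    ((expansion (vplus μ) f (N + 1) n k - if n = (k : ℕ) then 1 else 0) ∈ negLattice) ∧
      (n ≤ (k : ℕ) → expansion (vplus μ) f (N + 1) n k = if n = (k : ℕ) then 1 else 0) := by
  rw [expansion_vplus_apply, hf0, one_mul]
  simp only [Nat.cast_inj]
  rw [add_sub_cancel_left]
  constructor
  · refine Finset.sum_induction _ (· ∈ negLattice) (fun _ _ => negLattice_add) negLattice_zero
      fun c _ => ?_
    split_ifs
    · rw [mul_one]; exact hf c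
    · rw [mul_zero]; exact negLattice_zero
  · intro h
    rw [add_eq_left]
    refine Finset.sum_eq_zero fun c _ => ?_
    rw [if_neg (by omega), mul_zero]

/-- The vector `𝔱^{(n)}_odd v⁺` differs from `F^{(n)} v⁺` by a combination of the `F^{(r)} v⁺` with
`r < n` and coefficients in `q⁻¹ ℤ[q⁻¹]`. -/
theorem dv_smul_vplus_unitriangular {l n : ℕ} (hn : n < 2 * l + 1 + 1)
    (k : Fin (2 * l + 1 + 1)) :
    (((dv n • vplus (2 * l + 1)) k - if n = (k : ℕ) then 1 else 0) ∈ negLattice) ∧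
      (n ≤ (k : ℕ) → (dv n • vplus (2 * l + 1)) k = if n = (k : ℕ) then 1 else 0) := by
  obtain ⟨m, rfl | rfl⟩ := n.even_or_odd'
  · rw [(vplus_isWeight l).dv_smul_even m _ (Nat.lt_succ_self _)]
    exact expansion_vplus_unitriangular (evenCoeff_zero _ _)
      (evenCoeff_mem_negLattice (by omega)) _ _ k
  · rw [(vplus_isWeight l).dv_smul_odd m _ (Nat.lt_succ_self _)]
    exact expansion_vplus_unitriangular (oddCoeff_zero _ _)
      (oddCoeff_mem_negLattice (by omega)) _ _ k

lemma dv_smul_vplus_odd_eq_zero {l m : ℕ} (h : dv (2 * m) • vplus (2 * l + 1) = 0) :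
    dv (2 * m + 1) • vplus (2 * l + 1) = 0 := by
  have h1 := tU_smul_dv_even m (vplus (2 * l + 1))
  rw [h, smul_zero] at h1
  exact (smul_eq_zero.1 h1.symm).resolve_left (qint_ne_zero (by positivity))

/-- For `m = l + 1` the factor `1 - x ^ 0` kills all Gaussian binomial coefficients but the first,
which belongs to the vector `F^{(2l+2)} v⁺ = 0`. The recursion takes care of larger `m`. -/
lemma dv_smul_vplus_even_eq_zero {l m : ℕ} (hm : l < m) : dv (2 * m) • vplus (2 * l + 1) = 0 := by
  induction m, hm using Nat.le_induction with
  | base =>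
    rw [(vplus_isWeight l).dv_smul_even _ _ (Nat.lt_succ_self _)]
    funext k
    rw [expansion_vplus_apply, if_neg (by omega), L_zero_apply]
    simp only [mul_zero, zero_add]
    refine Finset.sum_eq_zero fun c _ => ?_
    have e : (l : ℤ) - (l.succ : ℕ) + 0 = -1 := by push_cast; ring
    rw [evenCoeff, e, gauss_neg_one, mul_zero, zero_mul]
  | succ m hm ih =>
    have h1 := tU_smul_dv_odd m (vplus (2 * l + 1))
    rw [ih, dv_smul_vplus_odd_eq_zero ih, smul_zero, smul_zero, add_zero] at h1
    exact (smul_eq_zero.1 h1.symm).resolve_left (qint_ne_zero (by positivity))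

theorem dv_smul_vplus_eq_zero {l n : ℕ} (hn : 2 * l + 1 < n) : dv n • vplus (2 * l + 1) = 0 := by
  obtain ⟨m, rfl | rfl⟩ := n.even_or_odd'
  · exact dv_smul_vplus_even_eq_zero (by omega)
  · exact dv_smul_vplus_odd_eq_zero (dv_smul_vplus_even_eq_zero (by omega))

/-! ### The `ı`-canonical basis of `L(2l + 1)` -/

/-- The transition matrix from the `𝔱^{(n)}_odd v⁺` to the `F^{(n)} v⁺` is unitriangular, so the top
nonzero coefficient of a combination is one of its coordinates. -/
lemma exists_top_coordinate {l : ℕ} {γ : Fin (2 * l + 1 + 1) → Qq} (hγ : γ ≠ 0) :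
    ∃ k, γ k ≠ 0 ∧ (∑ n, γ n • dv n • vplus (2 * l + 1)) k = γ k := by
  classical
  obtain ⟨i, hi⟩ := Function.ne_iff.1 hγ
  obtain ⟨k, hk, hmax⟩ := Finset.exists_max_image (Finset.univ.filter fun k => γ k ≠ 0) id
    ⟨i, by simpa using hi⟩
  refine ⟨k, by simpa using hk, ?_⟩
  rw [L_sum_apply, Finset.sum_eq_single_of_mem k (Finset.mem_univ k)]
  · rw [L_smul_apply, (dv_smul_vplus_unitriangular k.2 k).2 le_rfl, if_pos rfl, mul_one]
  · intro n _ hn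
    rw [L_smul_apply]
    rcases lt_or_gt_of_ne hn with h | h
    · rw [(dv_smul_vplus_unitriangular n.2 k).2 h.le, if_neg (by simpa [Fin.ext_iff] using hn),
        mul_zero]
    · have : γ n = 0 := by
        by_contra h0
        exact absurd (hmax n (by simpa using h0)) (not_le.2 h)
      rw [this, zero_mul]

lemma linearIndependent_dv_smul_vplus (l : ℕ) :
    LinearIndependent Qq (fun n : Fin (2 * l + 1 + 1) => dv n • vplus (2 * l + 1)) := by
  rw [Fintype.linearIndependent_iff]
  intro γ h
  by_contra hne
  obtain ⟨k, hk, hk'⟩ := exists_top_coordinate (γ := γ) (fun h0 => hne (congrFun h0))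
  rw [h] at hk'
  exact hk hk'.symm

lemma span_dv_smul_vplus (l : ℕ) : Submodule.span Qq
    (Set.range fun n : Fin (2 * l + 1 + 1) => dv n • vplus (2 * l + 1)) = ⊤ := by
  have : Module.Finite Qq (L (2 * l + 1)) :=
    inferInstanceAs (Module.Finite Qq (Fin (2 * l + 1 + 1) → Qq))
  refine (linearIndependent_dv_smul_vplus l).span_eq_top_of_card_eq_finrank ?_
  exact (Module.finrank_fintype_fun_eq_card Qq (η := Fin (2 * l + 1 + 1))).symm

/-- The basis of `L(2l + 1)` of the vectors `𝔱^{(n)}_odd v⁺`. -/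
def dvBasis (l : ℕ) : Module.Basis (Fin (2 * l + 1 + 1)) Qq (L (2 * l + 1)) :=
  Module.Basis.mk (linearIndependent_dv_smul_vplus l) (span_dv_smul_vplus l).ge

lemma dvBasis_apply (l : ℕ) (n : Fin (2 * l + 1 + 1)) :
    dvBasis l n = dv n • vplus (2 * l + 1) := by
  rw [dvBasis, Module.Basis.mk_apply]

/-- The bar involution of `L(2l + 1)`: the semilinear map that fixes the vectors
`𝔱^{(n)}_odd v⁺`. -/
def iotaBar (l : ℕ) : L (2 * l + 1) →ₛₗ[bar] L (2 * l + 1) where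
  toFun x := ∑ n, bar ((dvBasis l).repr x n) • dvBasis l n
  map_add' x y := by simp only [map_add, Finsupp.add_apply, add_smul, Finset.sum_add_distrib]
  map_smul' c x := by
    simp only [map_smul, Finsupp.smul_apply, smul_eq_mul, map_mul, mul_smul, Finset.smul_sum]

lemma iotaBar_dv_smul_vplus (l n : ℕ) :
    iotaBar l (dv n • vplus (2 * l + 1)) = dv n • vplus (2 * l + 1) := by
  rcases lt_or_ge n (2 * l + 1 + 1) with h | h
  · have h1 : iotaBar l (dvBasis l ⟨n, h⟩) = dvBasis l ⟨n, h⟩ := by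
      change ∑ i, bar ((dvBasis l).repr (dvBasis l ⟨n, h⟩) i) • dvBasis l i = _
      rw [Finset.sum_eq_single_of_mem ⟨n, h⟩ (Finset.mem_univ _)]
      · simp
      · intro i _ hi
        simp [Module.Basis.repr_self, Finsupp.single_eq_of_ne hi]
    rwa [dvBasis_apply] at h1
  · rw [dv_smul_vplus_eq_zero h, map_zero]

lemma iotaBar_tU_smul_dv (l n : ℕ) :
    iotaBar l (tU • dv n • vplus (2 * l + 1)) = tU • dv n • vplus (2 * l + 1) := by
  obtain ⟨m, rfl | rfl⟩ := n.even_or_odd'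
  · rw [tU_smul_dv_even, map_smulₛₗ, iotaBar_dv_smul_vplus, bar_qint]
  · rw [tU_smul_dv_odd, map_add, map_smulₛₗ, map_smulₛₗ _ (qint (2 * m + 1)),
      iotaBar_dv_smul_vplus, iotaBar_dv_smul_vplus, bar_qint, bar_qint]

lemma isIotaBar_iotaBar (l : ℕ) : IsIotaBar (2 * l + 1) (iotaBar l) where
  involutive x := by
    have h : ∀ x, iotaBar l x = ∑ n, bar ((dvBasis l).repr x n) • dvBasis l n := fun _ => rfl
    rw [h x, map_sum]
    conv_rhs => rw [← (dvBasis l).sum_repr x]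
    refine Finset.sum_congr rfl fun n _ => ?_
    rw [map_smulₛₗ, bar_bar, dvBasis_apply, iotaBar_dv_smul_vplus]
  map_t_smul x := by
    have h : (iotaBar l).comp (rep (2 * l + 1) tU) = (rep (2 * l + 1) tU).comp (iotaBar l) := by
      refine (dvBasis l).ext fun n => ?_
      rw [dvBasis_apply]
      change iotaBar l (tU • dv n • vplus (2 * l + 1))
        = tU • iotaBar l (dv n • vplus (2 * l + 1))
      rw [iotaBar_tU_smul_dv, iotaBar_dv_smul_vplus]
    exact LinearMap.congr_fun h x
  map_vplus := by
    have h := iotaBar_dv_smul_vplus l 0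
    rwa [dv_zero, one_smul] at h

/-- The recursion of the `ı`-divided powers has bar invariant coefficients, so a bar involution fixes
all the `𝔱^{(n)}_odd v⁺`. -/
lemma IsIotaBar.apply_dv_smul_vplus {l : ℕ} {ψ : L (2 * l + 1) →ₛₗ[bar] L (2 * l + 1)}
    (hψ : IsIotaBar (2 * l + 1) ψ) (n : ℕ) :
    ψ (dv n • vplus (2 * l + 1)) = dv n • vplus (2 * l + 1) := by
  have ht : ∀ x, ψ (tU • x) = tU • ψ x := hψ.map_t_smul
  have hodd : ∀ m, ψ (dv (2 * m) • vplus (2 * l + 1)) = dv (2 * m) • vplus (2 * l + 1) →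
      ψ (dv (2 * m + 1) • vplus (2 * l + 1)) = dv (2 * m + 1) • vplus (2 * l + 1) := by
    intro m hm
    have h0 := qint_ne_zero (m := 2 * (m : ℤ) + 1) (by positivity)
    have h := ht (dv (2 * m) • vplus (2 * l + 1))
    rw [hm, tU_smul_dv_even, map_smulₛₗ, bar_qint] at h
    exact smul_right_injective _ h0 h
  have heven : ∀ m, ψ (dv (2 * m) • vplus (2 * l + 1)) = dv (2 * m) • vplus (2 * l + 1) := by
    intro m
    induction m with
    | zero => rw [mul_zero, dv_zero, one_smul, hψ.map_vplus]
    | succ m ih =>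
      have h0 := qint_ne_zero (m := 2 * (m : ℤ) + 2) (by positivity)
      have h := ht (dv (2 * m + 1) • vplus (2 * l + 1))
      rw [hodd m ih, tU_smul_dv_odd, map_add, map_smulₛₗ, map_smulₛₗ _ (qint (2 * m + 1)), bar_qint,
        bar_qint, ih, add_left_inj] at h
      exact smul_right_injective _ h0 h
  obtain ⟨m, rfl | rfl⟩ := n.even_or_odd'
  · exact heven m
  · exact hodd m (heven m)

lemma IsIotaBar.eq_iotaBar {l : ℕ} {ψ : L (2 * l + 1) →ₛₗ[bar] L (2 * l + 1)}
    (hψ : IsIotaBar (2 * l + 1) ψ) : ψ = iotaBar l :=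
  (dvBasis l).ext fun n => by
    rw [dvBasis_apply, hψ.apply_dv_smul_vplus, iotaBar_dv_smul_vplus]

lemma eq_sum_Fdiv_iff {μ : ℕ} (x : L μ) (a : Fin (μ + 1)) (c : Fin (μ + 1) → Qq) :
    x = Fdiv a • vplus μ + ∑ r : Fin (μ + 1), c r • (Fdiv r • vplus μ) ↔
      ∀ k : Fin (μ + 1), x k = (if (a : ℕ) = k then 1 else 0) + c k := by
  have h : ∀ k : Fin (μ + 1),
      (Fdiv a • vplus μ + ∑ r : Fin (μ + 1), c r • (Fdiv r • vplus μ)) k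
        = (if (a : ℕ) = k then 1 else 0) + c k := by
    intro k
    rw [L_add_apply, Fdiv_smul_vplus_apply, L_sum_apply,
      Finset.sum_eq_single_of_mem k (Finset.mem_univ k)]
    · rw [L_smul_apply, Fdiv_smul_vplus_apply, if_pos rfl, mul_one]
    · intro r _ hr
      rw [L_smul_apply, Fdiv_smul_vplus_apply, if_neg (by simpa [Fin.ext_iff] using hr), mul_zero]
  exact ⟨fun hx k => by rw [hx, h], fun hx => funext fun k => by rw [hx, h]⟩

/-- The family `𝔱^{(n)}_odd v⁺` is the only `ı`-canonical basis. The difference with another one is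
bar invariant, so its coefficients in the basis `𝔱^{(n)}_odd v⁺` are bar invariant; the top one is
also a coordinate, which lies in `q⁻¹ ℤ[q⁻¹]`, hence it vanishes. -/
theorem isIotaCanonicalModule_iff {l : ℕ} (b : Fin (2 * l + 1 + 1) → L (2 * l + 1)) :
    IsIotaCanonicalModule (2 * l + 1) b ↔ ∀ n, b n = dv n • vplus (2 * l + 1) := by
  constructor
  · rintro ⟨ψ, hψ, hb⟩ a
    obtain ⟨hfix, c, hc, hbc⟩ := hb a
    rw [eq_sum_Fdiv_iff] at hbc
    obtain ⟨d, hd⟩ : ∃ d, d = b a - dv a • vplus (2 * l + 1) := ⟨_, rfl⟩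
    have hdψ : iotaBar l d = d := by
      rw [← hψ.eq_iotaBar, hd, map_sub, hfix, hψ.apply_dv_smul_vplus]
    have hdk : ∀ k, d k ∈ negLattice := by
      intro k
      have h := negLattice_sub (hc k) (dv_smul_vplus_unitriangular a.2 k).1
      rw [hd, L_sub_apply, hbc]
      convert h using 1
      ring
    have hbar : ∀ n, bar ((dvBasis l).repr d n) = (dvBasis l).repr d n := by
      intro n
      have h : ∑ n, bar ((dvBasis l).repr d n) • dvBasis l n = d := hdψ
      have h1 := (dvBasis l).repr_sum_self fun n => bar ((dvBasis l).repr d n)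
      rw [h] at h1
      exact (congrFun h1 n).symm
    have hsum : ∑ n, (dvBasis l).repr d n • dv n • vplus (2 * l + 1) = d := by
      conv_rhs => rw [← (dvBasis l).sum_repr d]
      simp only [dvBasis_apply]
    have hzero : (fun n => (dvBasis l).repr d n) = 0 := by
      by_contra hne
      obtain ⟨k, hk, hk'⟩ := exists_top_coordinate hne
      rw [hsum] at hk'
      exact hk (eq_zero_of_bar_eq (hk' ▸ hdk k) (hbar k))
    have hd0 : d = 0 := by
      rw [← hsum]
      exact Finset.sum_eq_zero fun n _ => by rw [congrFun hzero n, Pi.zero_apply, zero_smul]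
    exact sub_eq_zero.1 (hd.symm.trans hd0)
  · intro hb
    refine ⟨iotaBar l, isIotaBar_iotaBar l, fun a => ⟨?_, ?_⟩⟩
    · rw [hb, iotaBar_dv_smul_vplus]
    · refine ⟨_, fun k => (dv_smul_vplus_unitriangular a.2 k).1, ?_⟩
      rw [eq_sum_Fdiv_iff]
      intro k
      rw [hb]
      ring

/-! ### The family of the `ı`-divided powers in `𝐔^ı` -/

lemma linearCombination_dv_smul_vplus {l : ℕ} {f : ℕ →₀ Qq} (hf : ∀ n ∈ f.support, n ≤ l) :
    Finsupp.linearCombination Qq dv f • vplus (2 * l + 1)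
      = ∑ n : Fin (2 * l + 1 + 1), f n • dv n • vplus (2 * l + 1) := by
  rw [Fin.sum_univ_eq_sum_range (fun n => f n • dv n • vplus (2 * l + 1)),
    Finsupp.linearCombination_apply, Finsupp.sum_of_support_subset (s := Finset.range
      (2 * l + 1 + 1)) f (fun n hn => Finset.mem_range.2 (by have := hf n hn; omega)) _
      (fun n _ => zero_smul Qq (dv n)), Finset.sum_smul]
  exact Finset.sum_congr rfl fun n _ => smul_assoc (f n) (dv n : U) _

lemma exists_support_le (f : ℕ →₀ Qq) (N : ℕ) : ∃ l ≥ N, ∀ n ∈ f.support, n ≤ l :=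
  ⟨max N (f.support.sup id), le_max_left _ _, fun _ hn =>
    le_max_of_le_right (Finset.le_sup (f := id) hn)⟩

theorem linearIndependent_dv : LinearIndependent Qq dv := by
  intro f g hfg
  obtain ⟨N, -, hN⟩ := exists_support_le f 0
  obtain ⟨l, hNl, hl⟩ := exists_support_le g N
  have h := linearCombination_dv_smul_vplus fun n hn => (hN n hn).trans hNl
  rw [hfg, linearCombination_dv_smul_vplus hl, ← sub_eq_zero, ← Finset.sum_sub_distrib] at h
  simp only [← sub_smul] at h
  have h1 := Fintype.linearIndependent_iff.1 (linearIndependent_dv_smul_vplus l) _ h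
  ext n
  by_cases hn : n ≤ l
  · exact (sub_eq_zero.1 (h1 ⟨n, by omega⟩)).symm
  · rw [Finsupp.notMem_support_iff.1 fun h => hn ((hN n h).trans hNl),
      Finsupp.notMem_support_iff.1 fun h => hn (hl n h)]

lemma exists_eq_aeval_t (x : Ui) : ∃ p : Qq[X], aeval t p = x := by
  have h : (x : U) ∈ (aeval tU : Qq[X] →ₐ[Qq] U).range := by
    rw [← Algebra.adjoin_singleton_eq_range_aeval]
    exact x.2
  obtain ⟨p, hp⟩ := h
  refine ⟨p, Subtype.ext ?_⟩
  rw [← hp]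
  exact (aeval_algHom_apply Ui.val t p).symm

theorem span_dv : Submodule.span Qq (Set.range dv) = ⊤ := by
  have ht : ∀ x ∈ Submodule.span Qq (Set.range dv), t * x ∈ Submodule.span Qq (Set.range dv) := by
    intro x hx
    have hmem : ∀ n, dv n ∈ Submodule.span Qq (Set.range dv) :=
      fun n => Submodule.subset_span ⟨n, rfl⟩
    induction hx using Submodule.span_induction with
    | mem x hx =>
      obtain ⟨n, rfl⟩ := hx
      obtain ⟨m, rfl | rfl⟩ := n.even_or_odd'
      · rw [t_mul_dv_even]
        exact Submodule.smul_mem _ _ (hmem _)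
      · rw [t_mul_dv_odd]
        exact Submodule.add_mem _ (Submodule.smul_mem _ _ (hmem _))
          (Submodule.smul_mem _ _ (hmem _))
    | zero => rw [mul_zero]; exact Submodule.zero_mem _
    | add x y _ _ hx hy => rw [mul_add]; exact Submodule.add_mem _ hx hy
    | smul c x _ hx => rw [mul_smul_comm]; exact Submodule.smul_mem _ _ hx
  have hpow : ∀ n, t ^ n ∈ Submodule.span Qq (Set.range dv) := by
    intro n
    induction n with
    | zero => rw [pow_zero, ← dv_zero]; exact Submodule.subset_span ⟨0, rfl⟩
    | succ n ih => rw [pow_succ']; exact ht _ ih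
  rw [eq_top_iff]
  rintro x -
  obtain ⟨p, rfl⟩ := exists_eq_aeval_t x
  rw [aeval_eq_sum_range]
  exact Submodule.sum_mem _ fun n _ => Submodule.smul_mem _ _ (hpow n)

lemma exists_eq_linearCombination_dv (x : Ui) : ∃ f, Finsupp.linearCombination Qq dv f = x := by
  have hx : x ∈ Submodule.span Qq (Set.range dv) := by rw [span_dv]; trivial
  exact (Finsupp.mem_span_range_iff_exists_finsupp).1 hx

/-- An element of `𝐔^ı` is determined by its action on the highest weight vectors of odd weight. -/
lemma eq_zero_of_smul_vplus {x : Ui} (N : ℕ) (h : ∀ l ≥ N, x • vplus (2 * l + 1) = 0) :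
    x = 0 := by
  obtain ⟨f, rfl⟩ := exists_eq_linearCombination_dv x
  obtain ⟨l, hN, hl⟩ := exists_support_le f N
  have h1 := linearCombination_dv_smul_vplus hl
  rw [h l hN] at h1
  have h2 := Fintype.linearIndependent_iff.1 (linearIndependent_dv_smul_vplus l) _ h1.symm
  rw [Finsupp.linearCombination_apply]
  exact Finset.sum_eq_zero fun n hn => by
    have h3 : f n = 0 := h2 ⟨n, by have := hl n hn; omega⟩
    exact absurd h3 (Finsupp.mem_support_iff.1 hn)

theorem isIotaCanonicalOdd_iff (u : ℕ → Ui) : IsIotaCanonicalOdd u ↔ ∀ n, u n = dv n := by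
  constructor
  · intro h n
    obtain ⟨N, hN⟩ := h n
    refine sub_eq_zero.1 (eq_zero_of_smul_vplus N fun l hl => ?_)
    obtain ⟨b, hb, hn, hu⟩ := hN l hl
    rw [sub_smul, hu, (isIotaCanonicalModule_iff b).1 hb, sub_self]
  · intro h n
    refine ⟨n, fun l hl => ⟨fun k => dv k • vplus (2 * l + 1),
      (isIotaCanonicalModule_iff _).2 fun _ => rfl, by omega, ?_⟩⟩
    rw [h n]

/-! ### The bar involution of `𝐔^ı` -/

/-- The element `𝔱` is transcendental: otherwise `𝐔^ı` would be finite dimensional. -/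
lemma aeval_t_injective : Function.Injective (aeval t : Qq[X] →ₐ[Qq] Ui) := by
  rw [injective_iff_map_eq_zero]
  intro p hp
  by_contra hne
  have halg : IsAlgebraic Qq tU := ⟨p, hne, by
    have h := aeval_algHom_apply Ui.val t p
    rwa [hp, map_zero] at h⟩
  have hfin : Module.Finite Qq Ui :=
    Module.Finite.iff_fg.2 halg.isIntegral.fg_adjoin_singleton
  exact (Module.Finite.not_linearIndependent_of_infinite dv) linearIndependent_dv

lemma aeval_t_bijective : Function.Bijective (aeval t : Qq[X] →ₐ[Qq] Ui) :=
  ⟨aeval_t_injective, exists_eq_aeval_t⟩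

/-- The bar involution of `𝐔^ı`, which acts on the coefficients of polynomials in `𝔱`. -/
def iotaBarUi : Ui →+* Ui :=
  ((aeval t : Qq[X] →ₐ[Qq] Ui) : Qq[X] →+* Ui).comp ((mapRingHom bar).comp
    ((AlgEquiv.ofBijective _ aeval_t_bijective).symm : Ui →+* Qq[X]))

lemma iotaBarUi_aeval (p : Qq[X]) : iotaBarUi (aeval t p) = aeval t (p.map bar) := by
  have h : (AlgEquiv.ofBijective _ aeval_t_bijective).symm (aeval t p) = p :=
    (AlgEquiv.ofBijective _ aeval_t_bijective).symm_apply_apply p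
  change aeval t (Polynomial.map bar ((AlgEquiv.ofBijective _ aeval_t_bijective).symm
    (aeval t p))) = _
  rw [h]

lemma isIotaBarUi_iotaBarUi : IsIotaBarUi iotaBarUi where
  involutive x := by
    obtain ⟨p, rfl⟩ := exists_eq_aeval_t x
    have h : bar.comp bar = RingHom.id Qq := RingHom.ext bar_bar
    rw [iotaBarUi_aeval, iotaBarUi_aeval, Polynomial.map_map, h, Polynomial.map_id]
  map_algebraMap c := by
    rw [← aeval_C t, iotaBarUi_aeval, map_C, aeval_C]
  map_t := by
    have h := iotaBarUi_aeval X
    rwa [Polynomial.map_X, aeval_X] at h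

lemma IsIotaBarUi.apply_aeval {Ψ : Ui →+* Ui} (hΨ : IsIotaBarUi Ψ) (p : Qq[X]) :
    Ψ (aeval t p) = aeval t (p.map bar) := by
  induction p using Polynomial.induction_on' with
  | add p r hp hr => rw [map_add, map_add, hp, hr, Polynomial.map_add, map_add]
  | monomial n c =>
    rw [Polynomial.map_monomial, aeval_monomial, aeval_monomial, map_mul, map_pow,
      hΨ.map_algebraMap, hΨ.map_t]

lemma IsIotaBarUi.eq_iotaBarUi {Ψ : Ui →+* Ui} (hΨ : IsIotaBarUi Ψ) : Ψ = iotaBarUi := by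
  ext1 x
  obtain ⟨p, rfl⟩ := exists_eq_aeval_t x
  rw [hΨ.apply_aeval, iotaBarUi_aeval]

lemma map_bar_dvNum (a : ℕ) : (dvNum a).map bar = dvNum a := by
  simp [dvNum, Polynomial.map_prod, bar_qint]

lemma map_bar_dvPoly (n : ℕ) : (dvPoly n).map bar = dvPoly n := by
  rw [dvPoly, Polynomial.map_mul, map_C, map_inv₀, bar_qfact]
  split_ifs
  · rw [map_bar_dvNum]
  · rw [Polynomial.map_mul, Polynomial.map_X, map_bar_dvNum]

lemma IsIotaBarUi.apply_dv {Ψ : Ui →+* Ui} (hΨ : IsIotaBarUi Ψ) (n : ℕ) : Ψ (dv n) = dv n := by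
  rw [dv, hΨ.apply_aeval, map_bar_dvPoly]

/-! ### The integral form of `𝐔^ı` -/

/-- A relation between elements of `𝐔` in `𝐔̇ 1_μ` holds on the highest weight vector of `L(μ)`. -/
lemma smul_vplus_eq_of_smul_oneDot_eq {μ : ℕ} {x y : U} (h : x • oneDot μ = y • oneDot μ) :
    x • vplus μ = y • vplus μ := by
  have h1 : (Submodule.Quotient.mk (x • (1 : U)) : Udot μ)
    = Submodule.Quotient.mk (y • (1 : U)) := h
  rw [Submodule.Quotient.eq, smul_eq_mul, smul_eq_mul, mul_one, mul_one,
    Submodule.mem_span_singleton] at h1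
  obtain ⟨z, hz⟩ := h1
  have hK : (K - algebraMap Qq U (q ^ (μ : ℤ))) • vplus μ = 0 := by
    rw [sub_smul, K_smul_vplus, algebraMap_smul, zpow_natCast, sub_self]
  rw [← sub_eq_zero, ← sub_smul, ← hz, smul_eq_mul, mul_smul, hK, smul_zero]

/-- If a combination of the `𝔱^{(n)}_odd v⁺` has coordinates in `ℤ[q, q⁻¹]`, so are its coefficients:
the transition matrix is unitriangular over `ℤ[q, q⁻¹]`. -/
lemma coeff_mem_intLaurent {l : ℕ} {γ : Fin (2 * l + 1 + 1) → Qq}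
    (h : ∀ k, (∑ n, γ n • dv n • vplus (2 * l + 1)) k ∈ intLaurent) (n) : γ n ∈ intLaurent := by
  classical
  have hdv : ∀ n k : Fin (2 * l + 1 + 1), (dv n • vplus (2 * l + 1)) k ∈ intLaurent := by
    intro n k
    have h1 := negLattice_subset (dv_smul_vplus_unitriangular n.2 k).1
    have h2 : (if (n : ℕ) = k then (1 : Qq) else 0) ∈ intLaurent := by
      split_ifs
      · exact one_mem _
      · exact zero_mem _
    simpa using add_mem h1 h2
  -- the part of the combination whose coefficients are not in `ℤ[q, q⁻¹]`
  obtain ⟨δ, hδ⟩ : ∃ δ : Fin (2 * l + 1 + 1) → Qq, ∀ n, δ n = if γ n ∈ intLaurent then 0 else γ n :=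
    ⟨_, fun _ => rfl⟩
  have hsum : ∀ k, (∑ n, δ n • dv n • vplus (2 * l + 1)) k ∈ intLaurent := by
    intro k
    have h1 : (∑ n, δ n • dv n • vplus (2 * l + 1)) k =
        (∑ n, γ n • dv n • vplus (2 * l + 1)) k
          - ∑ n, (γ n - δ n) * (dv n • vplus (2 * l + 1)) k := by
      rw [L_sum_apply, L_sum_apply, ← Finset.sum_sub_distrib]
      refine Finset.sum_congr rfl fun n _ => ?_
      rw [L_smul_apply, L_smul_apply]
      ring
    rw [h1]
    refine sub_mem (h k) (sum_mem fun n _ => mul_mem ?_ (hdv n k))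
    rw [hδ]
    split_ifs with hn
    · simpa using hn
    · simp [zero_mem]
  by_contra hn
  have hne : δ ≠ 0 := fun h0 => by
    have h1 := hδ n
    rw [if_neg hn, h0] at h1
    exact hn (h1 ▸ zero_mem _)
  obtain ⟨k, hk, hk'⟩ := exists_top_coordinate hne
  have hmem := hk' ▸ hsum k
  rw [hδ] at hk hmem
  split_ifs at hk hmem with h1
  · exact hk rfl
  · exact h1 hmem

/-- An element of the integral form maps `1_{2l+1}` into the integral form of `𝐔̇ 1_{2l+1}`, hence
`v⁺` to a vector with coordinates in `ℤ[q, q⁻¹]`; for large `l` these coordinates determine its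
coefficients in the basis of the `ı`-divided powers. -/
theorem span_intLaurent_dv :
    (Submodule.span intLaurent (Set.range dv) : Set Ui) = UiIntOdd := by
  ext x
  constructor
  · intro hx
    refine Submodule.span_induction (p := fun x _ => x ∈ UiIntOdd) ?_ ?_ ?_ ?_ hx
    · rintro _ ⟨n, rfl⟩
      exact dv_mem_UiIntOdd n
    · intro ν _ m _
      rw [zero_smul]
      exact UdotInt_zero ν
    · intro x y _ _ hx hy ν hν m hm
      rw [add_smul]
      exact UdotInt_add (hx ν hν m hm) (hy ν hν m hm)
    · intro c x _ hx ν hν m hm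
      have h : (c • x) • m = (c : Qq) • x • m := smul_assoc (c : Qq) (x : U) m
      rw [h]
      exact UdotInt_smul (hx ν hν m hm) c.2
  · intro hx
    obtain ⟨f, rfl⟩ := exists_eq_linearCombination_dv x
    obtain ⟨l, -, hl⟩ := exists_support_le f 0
    obtain ⟨y, hy, hxy⟩ := hx (2 * l + 1 : ℕ) ⟨l, by push_cast; ring⟩ (oneDot _)
      ⟨1, one_mem _, (one_smul _ _).symm⟩
    have h1 : Finsupp.linearCombination Qq dv f • vplus (2 * l + 1) = y • vplus (2 * l + 1) :=
      smul_vplus_eq_of_smul_oneDot_eq hxy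
    have h2 : ∀ k, (y • vplus (2 * l + 1)) k ∈ intLaurent := by
      refine dividedPowerAlgebra_smul_apply_mem hy _ fun k => ?_
      simp only [vplus, ebasis]
      split_ifs
      · exact one_mem _
      · exact zero_mem _
    rw [← h1, linearCombination_dv_smul_vplus hl] at h2
    rw [Finsupp.linearCombination_apply]
    refine Submodule.sum_mem _ fun n hn => ?_
    have h3 : f n ∈ intLaurent := coeff_mem_intLaurent h2 ⟨n, by have := hl n hn; omega⟩
    exact Submodule.smul_mem _ (⟨f n, h3⟩ : intLaurent) (Submodule.subset_span ⟨n, rfl⟩)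

end IotaQuantum

end

open IotaQuantum in
theorem mainTheorem6 :
    (∀ l : ℕ,
      (∃! ψ : L (2 * l + 1) →ₛₗ[bar] L (2 * l + 1), IsIotaBar (2 * l + 1) ψ) ∧
      (∀ b : Fin (2 * l + 1 + 1) → L (2 * l + 1),
        IsIotaCanonicalModule (2 * l + 1) b ↔ ∀ n, b n = dv n • vplus (2 * l + 1)) ∧
      LinearIndependent Qq (fun n : Fin (2 * l + 1 + 1) => dv n • vplus (2 * l + 1)) ∧
      Submodule.span Qq
        (Set.range fun n : Fin (2 * l + 1 + 1) => dv n • vplus (2 * l + 1)) = ⊤ ∧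
      ∀ n : ℕ, 2 * l + 1 < n → dv n • vplus (2 * l + 1) = 0) ∧
    (∀ u : ℕ → Ui, IsIotaCanonicalOdd u ↔ ∀ n, u n = dv n) ∧
    LinearIndependent Qq dv ∧
    Submodule.span Qq (Set.range dv) = ⊤ ∧
    (∃! Ψ : Ui →+* Ui, IsIotaBarUi Ψ) ∧
    (∀ Ψ : Ui →+* Ui, IsIotaBarUi Ψ → ∀ n, Ψ (dv n) = dv n) ∧
    (Submodule.span intLaurent (Set.range dv) : Set Ui) = UiIntOdd :=
  ⟨fun l => ⟨⟨iotaBar l, isIotaBar_iotaBar l, fun _ hψ => hψ.eq_iotaBar⟩,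
      isIotaCanonicalModule_iff, linearIndependent_dv_smul_vplus l, span_dv_smul_vplus l,
      fun _ hn => dv_smul_vplus_eq_zero hn⟩,
    isIotaCanonicalOdd_iff, linearIndependent_dv, span_dv,
    ⟨iotaBarUi, isIotaBarUi_iotaBarUi, fun _ hΨ => hΨ.eq_iotaBarUi⟩,
    fun _ hΨ => hΨ.apply_dv, span_intLaurent_dv⟩
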